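/- **Setting.** There are $K\ge 1$ arms, a horizon $T\ge 1$, a dimension $d\ge 1$ and an unknown parameter $\theta^*\in\mathbb R^d$. In each round $t=1,\dots,T$, nature chooses (adversarially, possibly adaptively and at random) true contexts $x^*_{t,1},\dots,x^*_{t,K}\in\mathbb R^d$; the arms, independently of each other given the past and the true contexts, report contexts $x_{t,i}\in\mathbb R^d$; the learner, who sees only the reports, plays an arm $i_t$ and receives $r_{t,i_t}=\langle\theta^*,x^*_{t,i_t}\rangle+\eta_t$. It may also play no arm, which gives reward $0$. A strategy $\sigma_i$ of arm $i$ prescribes in each round a distribution over reports, given the past and the current true contexts. Given the past, the true contexts, the reports and the play, the noise $\eta_t$ has mean zero and is $1$-sub-Gaussian. Fix $\lambda>0$ and $S\ge0$. Assume $\|\theta^*\|_2\le S$, $\|x^*_{t,i}\|_2\le 1$ and $\langle\theta^*,x^*_{t,i}-x^*_{t,j}\rangle\le 1$ for all $t,i,j$. **Mechanism.** Let $m_{t,i}=\#\{\ell<t: i_\ell=i\}$, $n_t(i)=\#\{\ell\le t: i_\ell=i\}$, $V_{t,i}=\lambda I+\sum_{\ell<t:\,i_\ell=i}x_{\ell,i}x_{\ell,i}^\top$,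 $\hat\theta_{t,i}=V_{t,i}^{-1}\sum_{\ell<t:\,i_\ell=i}r_{\ell,i}\,x_{\ell,i}$ and $$\sqrt{\beta_{t,i}}=\sqrt{d\log\big((1+m_{t,i}/\lambda)\,T^2\big)}+\sqrt\lambda\,S .$$ Put $\mathrm{UCB}_{t,i}(x)=\langle\hat\theta_{t,i},x\rangle+\sqrt{\beta_{t,i}}\,\|x\|_{V_{t,i}^{-1}}$ and $\mathrm{LCB}_{t,i}(x)=\langle\hat\theta_{t,i},x\rangle-\sqrt{\beta_{t,i}}\,\|x\|_{V_{t,i}^{-1}}$. The Optimistic Grim Trigger Mechanism (OptGTM) starts with $A_1=\{1,\dots,K\}$. In round $t$ it plays some $i_t\in\arg\max_{i\in A_t}\mathrm{UCB}_{t,i}(x_{t,i})$ (ties are broken arbitrarily, possibly at random). It then sets $A_{t+1}=A_t\setminus\{i_t\}$ if, for $i=i_t$, $$\sum_{\ell\le t:\,i_\ell=i}\mathrm{LCB}_{\ell,i}(x_{\ell,i})>\sum_{\ell\le t:\,i_\ell=i}r_{\ell,i}+2\sqrt{n_t(i)\log T},$$ and $A_{t+1}=A_t$ otherwise. It plays no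 arm while $A_t=\emptyset$. **Equilibrium and regret.** Each arm $i$ has a set $\mathcal S_i$ of admissible strategies (arbitrary: for example all strategies, or those that use only what arm $i$ observes). A profile $\sigma\in\prod_i\mathcal S_i$ is a Nash equilibrium under OptGTM if no arm $i$ can increase its expected number of pulls $\mathbb E[n_T(i)]$ by a unilateral deviation to another strategy in $\mathcal S_i$. The strategic regret is $$R_T(\mathrm{OptGTM},\sigma)=\mathbb E\Big[\sum_{t=1}^T\big(\max_{i}\langle\theta^*,x^*_{t,i}\rangle-\langle\theta^*,x^*_{t,i_t}\rangle\big)\Big],$$ where $\langle\theta^*,x^*_{t,i_t}\rangle$ is read as $0$ if no arm is played. **Corollary.** For all $\lambda>0$ and $S\ge 0$ there is a constant $C>0$, depending only on $\lambda$ and $S$, such that the following holds for all $d,K,T\ge1$ and all environments as above. Let $\sigma$ be a Nash equilibrium under OptGTM such that, almost surely, all reports satisfy $\|x_{t,i}\|_2\le 1$ and the reports are linearly realizable: for every arm $i$ there is $\theta_i^*\in\mathbb R^d$ with $\|\theta_i^*\|_2\le S$ and $\langle\theta^*,x^*_{t,i}\rangle=\langle\theta_i^*,x_{t,i}\rangle$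 for all $t\le T$. Then $$R_T(\mathrm{OptGTM},\sigma)\le C\,d\,(1+\log T)\sqrt{KT}.$$ In particular, OptGTM has strategic regret $\tilde{\mathcal O}(d\sqrt{KT})$ in every such Nash equilibrium. -/

import Mathlib

open MeasureTheory ProbabilityTheory
open scoped Matrix

noncomputable section

namespace StrategicBandit

/-- Context and parameter space `ℝ^d` with the Euclidean norm. -/
abbrev Vec (d : ℕ) : Type := EuclideanSpace ℝ (Fin d)

/-- One context vector per arm. -/
abbrev Contexts (d K : ℕ) : Type := Fin K → Vec d

/-- The arm played in a round; `none` means that no arm is played. -/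
abbrev Play (K : ℕ) : Type := Option (Fin K)

instance instMeasurableSpacePlay (K : ℕ) : MeasurableSpace (Option (Fin K)) := ⊤

/-- What the learner sees in a round: the reported contexts, the arm played, the reward received. -/
abbrev ObsRound (d K : ℕ) : Type := Contexts d K × (Play K × ℝ)

/-- A complete round: the true contexts, followed by what the learner sees. -/
abbrev Round (d K : ℕ) : Type := Contexts d K × ObsRound d K

/-- The learner's history after `t` rounds. -/
abbrev ObsHist (d K t : ℕ) : Type := Fin t → ObsRound d K

/-- The complete history after `t` rounds. -/
abbrev Hist (d K t : ℕ) : Type := Fin t → Round d K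

variable {d K : ℕ}

/-! ## The Optimistic Grim Trigger Mechanism -/

namespace ObsRound

/-- Reported contexts. -/
def report (o : ObsRound d K) : Contexts d K := o.1

/-- Arm played. -/
def arm (o : ObsRound d K) : Play K := o.2.1

/-- Reward received. -/
def reward (o : ObsRound d K) : ℝ := o.2.2

end ObsRound

/-- The first `s` rounds of a history of `t ≥ s` rounds. -/
def prefixHist {α : Type} {t : ℕ} (h : Fin t → α) (s : ℕ) (hs : s ≤ t) : Fin s → α :=
  fun j => h (Fin.castLE hs j)

/-- The rounds of `h` in which arm `i` was played. -/
def pullRounds {t : ℕ} (h : ObsHist d K t) (i : Fin K) : Finset (Fin t) :=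
  Finset.univ.filter fun l => ObsRound.arm (h l) = some i

/-- The number of pulls of arm `i` in `h`. -/
def pulls {t : ℕ} (h : ObsHist d K t) (i : Fin K) : ℕ := (pullRounds h i).card

/-- `V_i = lam I + ∑ x xᵀ`, the sum over the reports of arm `i` in the rounds it was played. -/
def covMatrix (lam : ℝ) {t : ℕ} (h : ObsHist d K t) (i : Fin K) : Matrix (Fin d) (Fin d) ℝ :=
  lam • (1 : Matrix (Fin d) (Fin d) ℝ) +
    ∑ l ∈ pullRounds h i,
      Matrix.vecMulVec (ObsRound.report (h l) i).ofLp (ObsRound.report (h l) i).ofLp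

/-- The ridge regression estimator `V_i⁻¹ ∑ r x` from the reports and rewards of arm `i` alone. -/
def thetaHat (lam : ℝ) {t : ℕ} (h : ObsHist d K t) (i : Fin K) : Fin d → ℝ :=
  (covMatrix lam h i)⁻¹ *ᵥ
    ∑ l ∈ pullRounds h i, ObsRound.reward (h l) • (ObsRound.report (h l) i).ofLp

/-- The weighted norm `‖x‖_{V_i⁻¹}`. -/
def invNorm (lam : ℝ) {t : ℕ} (h : ObsHist d K t) (i : Fin K) (x : Vec d) : ℝ :=
  Real.sqrt (x.ofLp ⬝ᵥ ((covMatrix lam h i)⁻¹ *ᵥ x.ofLp))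

/-- The confidence radius `√β_i = √(d log ((1 + n(i)/lam) / δ)) + √lam S` with `δ = 1/T²`,
where `n(i)` counts the pulls of arm `i` in the past `h`. -/
def confRadius (T : ℕ) (lam S : ℝ) {t : ℕ} (h : ObsHist d K t) (i : Fin K) : ℝ :=
  Real.sqrt (d * Real.log ((1 + (pulls h i : ℝ) / lam) / (1 / (T : ℝ) ^ 2))) + Real.sqrt lam * S

/-- Optimistic estimate of the expected reward of a report `x` of arm `i`, given the past `h`. -/
def ucb (T : ℕ) (lam S : ℝ) {t : ℕ} (h : ObsHist d K t) (i : Fin K) (x : Vec d) : ℝ :=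
  thetaHat lam h i ⬝ᵥ x.ofLp + confRadius T lam S h i * invNorm lam h i x

/-- Pessimistic estimate of the expected reward of a report `x` of arm `i`, given the past `h`. -/
def lcb (T : ℕ) (lam S : ℝ) {t : ℕ} (h : ObsHist d K t) (i : Fin K) (x : Vec d) : ℝ :=
  thetaHat lam h i ⬝ᵥ x.ofLp - confRadius T lam S h i * invNorm lam h i x

/-- The grim trigger condition for arm `i`, evaluated at the end of the rounds in `h`: the sum of
the pessimistic estimates, each formed with the data available in its own round, exceeds the
optimistic estimate of the total observed reward. -/
def Triggered (T : ℕ) (lam S : ℝ) {t : ℕ} (h : ObsHist d K t) (i : Fin K) : Prop :=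
  ∑ l ∈ pullRounds h i, ObsRound.reward (h l)
      + 2 * Real.sqrt ((pulls h i : ℝ) * Real.log T)
    < ∑ l ∈ pullRounds h i,
        lcb T lam S (prefixHist h l.val l.isLt.le) i (ObsRound.report (h l) i)

/-- Arm `i` is active after the rounds in `h`: the trigger condition, which is checked at the end of
each round for the arm just played, has never held for arm `i`. -/
def Active (T : ℕ) (lam S : ℝ) {t : ℕ} (h : ObsHist d K t) (i : Fin K) : Prop :=
  ∀ s : Fin t, ObsRound.arm (h s) = some i →
    ¬ Triggered T lam S (prefixHist h (s.val + 1) s.isLt) i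

/-- The plays the mechanism may make after the history `h` when the reports are `x`: an active arm
of maximal optimistic reported reward, and no arm if no arm is active. -/
def optGTMChoices (T : ℕ) (lam S : ℝ) {t : ℕ} (h : ObsHist d K t) (x : Contexts d K) :
    Set (Play K) :=
  {a | (∃ i, a = some i ∧ Active T lam S h i ∧
          ∀ j, Active T lam S h j → ucb T lam S h j (x j) ≤ ucb T lam S h i (x i)) ∨
       (a = none ∧ ∀ i, ¬ Active T lam S h i)}

/-- A (possibly randomized) learning algorithm: in each round, a distribution over plays, given the
learner's history and the current reports. -/
structure Algorithm (d K : ℕ) where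
  select : ∀ t : ℕ, Kernel (ObsHist d K t × Contexts d K) (Play K)
  markov : ∀ t, IsMarkovKernel (select t)

/-- `M` is the Optimistic Grim Trigger Mechanism with horizon `T`, regularization `lam` and
parameter bound `S`. Ties in the argmax may be broken in any way, also at random. -/
def IsOptGTM (T : ℕ) (lam S : ℝ) (M : Algorithm d K) : Prop :=
  ∀ (t : ℕ) (h : ObsHist d K t) (x : Contexts d K),
    ∀ᵐ a ∂(M.select t (h, x)), a ∈ optGTMChoices T lam S h x

/-! ## Environment, strategies, interaction -/

/-- The environment: the reward parameter, nature's choice of the true contexts (possibly adaptive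
and random), and the conditional law of the noise given the past, the true contexts, the reports and
the play of the current round. -/
structure Environment (d K : ℕ) where
  theta : Vec d
  nature : ∀ t : ℕ, Kernel (Hist d K t) (Contexts d K)
  noise : ∀ t : ℕ, Kernel (Hist d K t × ((Contexts d K × Contexts d K) × Play K)) ℝ
  nature_markov : ∀ t, IsMarkovKernel (nature t)
  noise_markov : ∀ t, IsMarkovKernel (noise t)

/-- The standing regularity assumptions: `‖θ*‖ ≤ S`, true contexts of norm at most `1`, gaps of the
mean rewards at most `1`, and conditionally `1`-sub-Gaussian noise
(`E exp (s η) ≤ exp (s² / 2)` for all real `s`, so that `η` has mean zero). -/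
structure Environment.Regular (env : Environment d K) (S : ℝ) : Prop where
  norm_theta_le : ‖env.theta‖ ≤ S
  nature_bounded : ∀ (t : ℕ) (h : Hist d K t), ∀ᵐ x ∂(env.nature t h),
    (∀ i, ‖x i‖ ≤ 1) ∧ ∀ i j, inner ℝ env.theta (x i - x j) ≤ 1
  noise_subGaussian : ∀ (t : ℕ) (p : Hist d K t × ((Contexts d K × Contexts d K) × Play K)),
    HasSubgaussianMGF (fun e : ℝ => e) 1 (env.noise t p)

/-- A mixed, history-dependent strategy of an arm: in each round, a distribution over reported
contexts, given the past and the current true contexts. Which part of this information an arm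
may actually use is a matter of the class of admissible strategies, see `IsNash`. -/
structure Strategy (d K : ℕ) where
  report : ∀ t : ℕ, Kernel (Hist d K t × Contexts d K) (Vec d)
  markov : ∀ t, IsMarkovKernel (report t)

/-- The joint law of the reports of round `t`: the arms draw their reports independently of each
other, given the past and the current true contexts. -/
def jointReport (σ : Fin K → Strategy d K) (t : ℕ) :
    Kernel (Hist d K t × Contexts d K) (Contexts d K) where
  toFun p := Measure.pi fun i => (σ i).report t p
  measurable' := by
    have : ∀ i, IsMarkovKernel ((σ i).report t) := fun i => (σ i).markov t
    refine Measurable.measure_of_isPiSystem_of_isProbabilityMeasure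
      generateFrom_pi.symm isPiSystem_pi ?_
    rintro s ⟨u, hu, rfl⟩
    simp only [Measure.pi_pi]
    exact Finset.measurable_prod _ fun i _ =>
      Kernel.measurable_coe _ (hu i (Set.mem_univ i))

/-- The part of a complete history that the learner sees. -/
def obsHist {t : ℕ} (h : Hist d K t) : ObsHist d K t := fun s => (h s).2

theorem measurable_obsHist {t : ℕ} :
    Measurable (obsHist : Hist d K t → ObsHist d K t) :=
  measurable_pi_lambda _ fun s => (measurable_pi_apply s).snd

/-- The learner's choice in round `t`; it depends on the learner's history and the reports only. -/
def Algorithm.play (M : Algorithm d K) (t : ℕ) :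
    Kernel (Hist d K t × (Contexts d K × Contexts d K)) (Play K) :=
  (M.select t).comap (fun p => (obsHist p.1, p.2.2))
    ((measurable_obsHist.comp measurable_fst).prodMk (measurable_snd.comp measurable_snd))

/-- The mean reward `⟨θ*, x*_i⟩` of a play, given the true contexts; `0` if no arm is played. -/
def meanReward (θ : Vec d) (x : Contexts d K) : Play K → ℝ
  | some i => inner ℝ θ (x i)
  | none => 0

/-- The round that results from true contexts, reports, play and noise. If no arm is played, the
reward is `0`. -/
def mkRound (θ : Vec d) (q : ((Contexts d K × Contexts d K) × Play K) × ℝ) : Round d K :=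
  (q.1.1.1, (q.1.1.2, (q.1.2,
    match q.1.2 with
    | some i => meanReward θ q.1.1.1 (some i) + q.2
    | none => 0)))

/-- The conditional law of round `t` given the past: nature draws the true contexts, the arms report,
the learner plays, the noise is drawn. -/
def roundKernel (env : Environment d K) (M : Algorithm d K) (σ : Fin K → Strategy d K) (t : ℕ) :
    Kernel (Hist d K t) (Round d K) :=
  (((env.nature t ⊗ₖ jointReport σ t) ⊗ₖ M.play t) ⊗ₖ env.noise t).map (mkRound env.theta)

/-- The law of the first `t` rounds. -/
def law (env : Environment d K) (M : Algorithm d K) (σ : Fin K → Strategy d K) :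
    ∀ t : ℕ, Measure (Hist d K t)
  | 0 => Measure.dirac Fin.elim0
  | t + 1 =>
    ((law env M σ t) ⊗ₘ (roundKernel env M σ t)).map
      fun p => (Fin.snoc p.1 p.2 : Hist d K (t + 1))

/-! ## Equilibrium, regret, realizability -/

/-- The utility of arm `i`: the expected number of its pulls in `T` rounds. -/
def utility (env : Environment d K) (M : Algorithm d K) (T : ℕ) (σ : Fin K → Strategy d K)
    (i : Fin K) : ℝ :=
  ∫ h, (pulls (obsHist h) i : ℝ) ∂(law env M σ T)

/-- `σ` is a Nash equilibrium under `M` of the game in which arm `i` may use the strategies in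
`Adm i`: no arm gains by a unilateral deviation to an admissible strategy. `Adm i = Set.univ` allows
every strategy; a smaller `Adm i` expresses what arm `i` observes, or a restriction on its reports. -/
def IsNash (env : Environment d K) (M : Algorithm d K) (T : ℕ)
    (Adm : Fin K → Set (Strategy d K)) (σ : Fin K → Strategy d K) : Prop :=
  (∀ i, σ i ∈ Adm i) ∧
    ∀ i, ∀ σ' ∈ Adm i, utility env M T (Function.update σ i σ') i ≤ utility env M T σ i

/-- The strategic regret `E[∑ₜ (max_i ⟨θ*, x*_{t,i}⟩ - ⟨θ*, x*_{t,i_t}⟩)]` over `T` rounds. -/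
def regret (env : Environment d K) (M : Algorithm d K) (T : ℕ) (σ : Fin K → Strategy d K) : ℝ :=
  ∫ h, ∑ t : Fin T,
      ((⨆ i : Fin K, inner ℝ env.theta ((h t).1 i))
        - meanReward env.theta (h t).1 (ObsRound.arm (h t).2))
    ∂(law env M σ T)

/-- Linear realizability of the reports, with parameters of norm at most `S`: almost surely, for
every arm there is one vector `θ_i*` with `⟨θ*, x*_{t,i}⟩ = ⟨θ_i*, x_{t,i}⟩` in all rounds. -/
def LinearlyRealizable (env : Environment d K) (M : Algorithm d K) (T : ℕ) (S : ℝ)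
    (σ : Fin K → Strategy d K) : Prop :=
  ∀ᵐ h ∂(law env M σ T), ∀ i : Fin K, ∃ θi : Vec d, ‖θi‖ ≤ S ∧
    ∀ t : Fin T, inner ℝ env.theta ((h t).1 i) = inner ℝ θi (ObsRound.report (h t).2 i)

/-- Almost surely, all reported contexts have Euclidean norm at most `1`. -/
def BoundedReports (env : Environment d K) (M : Algorithm d K) (T : ℕ)
    (σ : Fin K → Strategy d K) : Prop :=
  ∀ᵐ h ∂(law env M σ T), ∀ (t : Fin T) (i : Fin K), ‖ObsRound.report (h t).2 i‖ ≤ 1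

end StrategicBandit

end

/-! By realizability, the rewards of arm `i` follow a linear model in its own reports, with
parameter θ_i*, so a separate ridge regression per arm makes sense. Its error splits into a noise
part V⁻¹∑ηx and a bias part -lam V⁻¹θ_i* (`thetaHat_eq`). The noise part does not involve θ_i*, so
it can be controlled although θ_i* may depend on the whole history; the bias costs at most √lam S.

On the event `NoiseBounded` all confidence intervals are valid. Then each LCB is at most the mean
reward, and the noise of an arm with n pulls sums to at least -2√(n log T), so the trigger cannot
fire (`not_triggered`). All arms stay active, the mechanism is plain optimism, and a round costs at
most twice the width of the played arm's interval (`round_regret_le`). Radii are of order √(d(1 +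
log T)) and each arm's squared weighted norms sum to order d(1 + log T) by the elliptical potential
lemma, so Cauchy-Schwarz over rounds gives d(1 + log T)√(KT) (`sum_regret_le`).

The good event comes from two families of nonnegative supermartingales: a self-normalized process
per arm for the intervals, and exponential processes for the noise sums. Weighted and added they
form one supermartingale with initial value 2K, and the good event holds unless it reaches T.
Ville's inequality bounds that probability by 2K/T. The regret never exceeds 2ST in absolute value,
so the bad event costs at most 2S min(2K, T) ≤ 4S√(KT).

The self-normalized process needs no mixture over ℝ^d: the rank one update formulas reduce its
one-step inequality to the scalar bound `lintegral_exp_quadratic_le`. -/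

namespace StrategicBandit

/-! ## Positive definite matrices -/

section LinearAlgebra

variable {n : Type*} [Fintype n]

theorem posDef_add_vecMulVec {V : Matrix n n ℝ} (hV : V.PosDef) (x : n → ℝ) :
    (V + Matrix.vecMulVec x x).PosDef := by
  simpa using hV.add_posSemidef (Matrix.posSemidef_vecMulVec_self_star x)

theorem measurable_dotProduct {α : Type*} [MeasurableSpace α] {x y : α → n → ℝ}
    (hx : ∀ i, Measurable fun a => x a i) (hy : ∀ i, Measurable fun a => y a i) :
    Measurable fun a => x a ⬝ᵥ y a :=
  Finset.measurable_fun_sum _ fun i _ => (hx i).mul (hy i)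

variable [DecidableEq n]

theorem dotProduct_inv_mulVec_comm {V : Matrix n n ℝ} (hV : V.PosDef) (x y : n → ℝ) :
    x ⬝ᵥ (V⁻¹ *ᵥ y) = y ⬝ᵥ (V⁻¹ *ᵥ x) := by
  have h : (V⁻¹)ᵀ = V⁻¹ := by simpa using hV.inv.isHermitian.eq
  rw [Matrix.dotProduct_mulVec, ← Matrix.mulVec_transpose, h, dotProduct_comm]

theorem dotProduct_inv_mulVec_nonneg {V : Matrix n n ℝ} (hV : V.PosDef) (x : n → ℝ) :
    0 ≤ x ⬝ᵥ (V⁻¹ *ᵥ x) := by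
  simpa using hV.inv.posSemidef.dotProduct_mulVec_nonneg x

/-- The matrix determinant lemma. -/
theorem det_add_vecMulVec {V : Matrix n n ℝ} (hV : V.PosDef) (x : n → ℝ) :
    (V + Matrix.vecMulVec x x).det = V.det * (1 + x ⬝ᵥ (V⁻¹ *ᵥ x)) := by
  have hu : IsUnit V.det := hV.det_pos.ne'.isUnit
  rw [Matrix.vecMulVec_eq Unit, Matrix.det_add_replicateCol_mul_replicateRow hu]
  congr 1
  rw [Matrix.mul_assoc, ← Matrix.replicateCol_mulVec]
  simp [Matrix.replicateRow_mul_replicateCol_apply]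

/-- The Sherman-Morrison formula. -/
theorem inv_add_vecMulVec_mulVec {V : Matrix n n ℝ} (hV : V.PosDef) (x s : n → ℝ) :
    (V + Matrix.vecMulVec x x)⁻¹ *ᵥ s =
      V⁻¹ *ᵥ s - ((x ⬝ᵥ (V⁻¹ *ᵥ s)) / (1 + x ⬝ᵥ (V⁻¹ *ᵥ x))) • (V⁻¹ *ᵥ x) := by
  have hu : IsUnit V.det := hV.det_pos.ne'.isUnit
  have hu' : IsUnit (V + Matrix.vecMulVec x x).det :=
    (posDef_add_vecMulVec hV x).det_pos.ne'.isUnit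
  have hw : 1 + x ⬝ᵥ (V⁻¹ *ᵥ x) ≠ 0 := by
    have := dotProduct_inv_mulVec_nonneg hV x
    positivity
  have hVV : ∀ y, V *ᵥ (V⁻¹ *ᵥ y) = y := fun y => by
    rw [Matrix.mulVec_mulVec, Matrix.mul_nonsing_inv _ hu, Matrix.one_mulVec]
  -- The claimed vector is checked to solve the updated linear system; invertibility then identifies
  -- it.
  have key : (V + Matrix.vecMulVec x x) *ᵥ
      (V⁻¹ *ᵥ s - ((x ⬝ᵥ (V⁻¹ *ᵥ s)) / (1 + x ⬝ᵥ (V⁻¹ *ᵥ x))) • (V⁻¹ *ᵥ x)) = s := by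
    rw [Matrix.add_mulVec, Matrix.mulVec_sub, Matrix.mulVec_smul, hVV, hVV,
      Matrix.vecMulVec_mulVec]
    ext j
    simp only [dotProduct_sub, dotProduct_smul, smul_eq_mul, Pi.add_apply, Pi.sub_apply,
      Pi.smul_apply, MulOpposite.smul_eq_mul_unop, MulOpposite.unop_op]
    field_simp
    ring
  nth_rewrite 1 [← key]
  rw [Matrix.mulVec_mulVec, Matrix.nonsing_inv_mul _ hu', Matrix.one_mulVec]

/-- The weighted norm of a sum after a rank one update. -/
theorem quadForm_inv_add_vecMulVec {V : Matrix n n ℝ} (hV : V.PosDef) (x s : n → ℝ) (e : ℝ) :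
    (s + e • x) ⬝ᵥ ((V + Matrix.vecMulVec x x)⁻¹ *ᵥ (s + e • x)) =
      s ⬝ᵥ (V⁻¹ *ᵥ s) - (x ⬝ᵥ (V⁻¹ *ᵥ s)) ^ 2 / (1 + x ⬝ᵥ (V⁻¹ *ᵥ x))
        + 2 * (e * (x ⬝ᵥ (V⁻¹ *ᵥ s) / (1 + x ⬝ᵥ (V⁻¹ *ᵥ x)))
          + e ^ 2 * ((x ⬝ᵥ (V⁻¹ *ᵥ x) / (1 + x ⬝ᵥ (V⁻¹ *ᵥ x))) / 2)) := by
  have hw : 1 + x ⬝ᵥ (V⁻¹ *ᵥ x) ≠ 0 := by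
    have := dotProduct_inv_mulVec_nonneg hV x
    positivity
  rw [inv_add_vecMulVec_mulVec hV]
  simp only [Matrix.mulVec_add, Matrix.mulVec_smul, dotProduct_sub, dotProduct_add, add_dotProduct,
    dotProduct_smul, smul_dotProduct, smul_eq_mul, dotProduct_inv_mulVec_comm hV s x]
  field_simp
  ring

/-- Cauchy-Schwarz for the form V⁻¹: the quadratic polynomial t ↦ ‖x + t y‖² is nonnegative, so its
discriminant is not positive. -/
theorem abs_dotProduct_inv_mulVec_le {V : Matrix n n ℝ} (hV : V.PosDef) (x y : n → ℝ) :
    |x ⬝ᵥ (V⁻¹ *ᵥ y)| ≤ √(x ⬝ᵥ (V⁻¹ *ᵥ x)) * √(y ⬝ᵥ (V⁻¹ *ᵥ y)) := by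
  have hx := dotProduct_inv_mulVec_nonneg hV x
  have h : ∀ t : ℝ, 0 ≤ y ⬝ᵥ (V⁻¹ *ᵥ y) * (t * t) + 2 * (x ⬝ᵥ (V⁻¹ *ᵥ y)) * t
      + x ⬝ᵥ (V⁻¹ *ᵥ x) := fun t => by
    have := dotProduct_inv_mulVec_nonneg hV (x + t • y)
    simp only [Matrix.mulVec_add, Matrix.mulVec_smul, dotProduct_add, add_dotProduct,
      dotProduct_smul, smul_dotProduct, smul_eq_mul, dotProduct_inv_mulVec_comm hV y x] at this
    linarith
  have hd := discrim_le_zero h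
  rw [discrim] at hd
  rw [← Real.sqrt_mul hx]
  apply Real.abs_le_sqrt
  linarith

/-- If `lam I ≤ V`, then `‖x‖²` weighted by `V⁻¹` is at most `‖x‖² / lam`. -/
theorem dotProduct_inv_mulVec_le {V : Matrix n n ℝ} (hV : V.PosDef) {lam : ℝ} (hlam : 0 < lam)
    (h : ∀ y : n → ℝ, lam * (y ⬝ᵥ y) ≤ y ⬝ᵥ (V *ᵥ y)) (x : n → ℝ) :
    x ⬝ᵥ (V⁻¹ *ᵥ x) ≤ (x ⬝ᵥ x) / lam := by
  have hu : IsUnit V.det := hV.det_pos.ne'.isUnit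
  have hy := h (V⁻¹ *ᵥ x)
  rw [Matrix.mulVec_mulVec, Matrix.mul_nonsing_inv _ hu, Matrix.one_mulVec,
    dotProduct_comm _ x] at hy
  -- With u = V⁻¹x the hypothesis reads lam ‖u‖² ≤ ⟨x, u⟩. Inserted into the expansion of ‖x - lam
  -- u‖² ≥ 0, it leaves lam ⟨x, u⟩ ≤ ‖x‖².
  have hsq : 0 ≤ (x - lam • V⁻¹ *ᵥ x) ⬝ᵥ (x - lam • V⁻¹ *ᵥ x) := by
    simpa using dotProduct_star_self_nonneg (x - lam • V⁻¹ *ᵥ x)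
  simp only [dotProduct_sub, sub_dotProduct, smul_dotProduct, dotProduct_smul, smul_eq_mul,
    dotProduct_comm (V⁻¹ *ᵥ x) x] at hsq
  rw [le_div_iff₀ hlam]
  nlinarith

/-- The determinant is the product of the positive eigenvalues, and the hypothesis at a unit
eigenvector bounds each of them by `b`. -/
theorem det_le_pow_of_quadForm_le {V : Matrix n n ℝ} (hV : V.PosDef) {b : ℝ}
    (h : ∀ y : n → ℝ, y ⬝ᵥ (V *ᵥ y) ≤ b * (y ⬝ᵥ y)) : V.det ≤ b ^ Fintype.card n := by
  have hH := hV.isHermitian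
  rw [hH.det_eq_prod_eigenvalues, ← Finset.card_univ, ← Finset.prod_const]
  refine Finset.prod_le_prod (fun i _ => (hV.eigenvalues_pos i).le) fun i _ => ?_
  have hi := hH.eigenvalues_eq i
  have h1 : (hH.eigenvectorBasis i).ofLp ⬝ᵥ (hH.eigenvectorBasis i).ofLp = 1 := by
    have := hH.eigenvectorBasis.orthonormal.1 i
    have h2 := real_inner_self_eq_norm_sq (hH.eigenvectorBasis i)
    rw [this, EuclideanSpace.inner_eq_star_dotProduct] at h2
    simpa using h2
  have := h (hH.eigenvectorBasis i).ofLp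
  rw [h1, mul_one] at this
  simpa [hi] using this

/-! ### Measurability of determinants and inverses -/

theorem measurable_matrix_det {α : Type*} [MeasurableSpace α] {A : α → Matrix n n ℝ}
    (hA : ∀ i j, Measurable fun a => A a i j) : Measurable fun a => (A a).det := by
  simp only [Matrix.det_apply]
  refine Finset.measurable_fun_sum _ fun p _ => ?_
  exact (Finset.measurable_fun_prod _ fun i _ => hA _ _).const_smul _

theorem measurable_matrix_inv {α : Type*} [MeasurableSpace α] {A : α → Matrix n n ℝ}
    (hA : ∀ i j, Measurable fun a => A a i j) (i j : n) : Measurable fun a => (A a)⁻¹ i j := by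
  simp only [Matrix.inv_def, Matrix.smul_apply, Matrix.adjugate_apply, Ring.inverse_eq_inv',
    smul_eq_mul]
  refine (measurable_matrix_det hA).inv.mul (measurable_matrix_det fun k l => ?_)
  by_cases hk : k = j
  · subst hk; simp
  · simpa [Matrix.updateRow_ne hk] using hA k l

end LinearAlgebra

/-! ## A moment inequality for sub-Gaussian variables -/

theorem lintegral_exp_mul_le {ν : Measure ℝ} (hν : HasSubgaussianMGF (fun e : ℝ => e) 1 ν)
    (t : ℝ) :
    ∫⁻ e, ENNReal.ofReal (Real.exp (t * e)) ∂ν ≤ ENNReal.ofReal (Real.exp (t ^ 2 / 2)) := by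
  rw [← ofReal_integral_eq_lintegral_ofReal (hν.integrable_exp_mul t)
    (ae_of_all _ fun _ => (Real.exp_pos _).le)]
  exact ENNReal.ofReal_le_ofReal (by simpa [mgf] using hν.mgf_le t)

theorem lintegral_exp_mul_gaussian (t : ℝ) :
    ∫⁻ g, ENNReal.ofReal (Real.exp (t * g)) ∂(gaussianReal 0 1) =
      ENNReal.ofReal (Real.exp (t ^ 2 / 2)) := by
  rw [← ofReal_integral_eq_lintegral_ofReal (integrable_exp_mul_gaussianReal t)
    (ae_of_all _ fun _ => (Real.exp_pos _).le)]
  congr 1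
  have := congrFun (mgf_fun_id_gaussianReal (μ := 0) (v := 1)) t
  simpa [mgf] using this

/-- The moment generating function of a squared shifted standard Gaussian. -/
theorem lintegral_exp_sq_gaussian (b q : ℝ) (hq : 0 ≤ q) (hq1 : q < 1) :
    ∫⁻ g, ENNReal.ofReal (Real.exp ((b + √q * g) ^ 2 / 2)) ∂(gaussianReal 0 1) =
      ENNReal.ofReal ((√(1 - q))⁻¹ * Real.exp (b ^ 2 / (2 * (1 - q)))) := by
  have hc : 0 < 1 - q := by linarith
  obtain ⟨v, hv⟩ : ∃ v : NNReal, (v : ℝ) = (1 - q)⁻¹ := ⟨⟨(1 - q)⁻¹, by positivity⟩, rfl⟩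
  have hv0 : v ≠ 0 := by
    rintro rfl
    simp only [NNReal.coe_zero] at hv
    have : 0 < (1 - q)⁻¹ := by positivity
    linarith
  rw [gaussianReal_of_var_ne_zero 0 one_ne_zero,
    lintegral_withDensity_eq_lintegral_mul _ (measurable_gaussianPDF _ _) (by fun_prop)]
  -- Completing the square turns the integrand into a constant times the Gaussian density with mean
  -- b√q/(1 - q) and variance v = 1/(1 - q), which integrates to 1.
  have h : ∀ g : ℝ, (gaussianPDF 0 1 * fun g => ENNReal.ofReal (Real.exp ((b + √q * g) ^ 2 / 2))) g
      = ENNReal.ofReal ((√(1 - q))⁻¹ * Real.exp (b ^ 2 / (2 * (1 - q))))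
        * gaussianPDF (b * √q / (1 - q)) v g := fun g => by
    simp only [Pi.mul_apply, gaussianPDF, gaussianPDFReal]
    rw [← ENNReal.ofReal_mul (by positivity), ← ENNReal.ofReal_mul (by positivity)]
    congr 1
    have h1 : (√(2 * Real.pi * (v : ℝ)))⁻¹ = √(1 - q) * (√(2 * Real.pi))⁻¹ := by
      rw [hv, Real.sqrt_mul (by positivity), Real.sqrt_inv, mul_inv, inv_inv, mul_comm]
    have h2 : √(1 - q) ≠ 0 := (Real.sqrt_pos.2 hc).ne'
    rw [h1, mul_assoc, ← Real.exp_add]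
    have h3 : (√(1 - q))⁻¹ * Real.exp (b ^ 2 / (2 * (1 - q))) *
        (√(1 - q) * (√(2 * Real.pi))⁻¹ *
          Real.exp (-(g - b * √q / (1 - q)) ^ 2 / (2 * (v : ℝ)))) =
        (√(2 * Real.pi))⁻¹ * Real.exp (b ^ 2 / (2 * (1 - q))
          + -(g - b * √q / (1 - q)) ^ 2 / (2 * (v : ℝ))) := by
      rw [Real.exp_add]
      field_simp
    rw [h3]
    have h4 : -(g - 0) ^ 2 / (2 * ((1 : NNReal) : ℝ)) + (b + √q * g) ^ 2 / 2 =
        b ^ 2 / (2 * (1 - q)) + -(g - b * √q / (1 - q)) ^ 2 / (2 * (v : ℝ)) := by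
      have hs : √q ^ 2 = q := Real.sq_sqrt hq
      rw [hv, NNReal.coe_one]
      field_simp
      ring_nf
      rw [hs]
      ring
    rw [h4]
    simp
  simp_rw [h]
  rw [lintegral_const_mul _ (measurable_gaussianPDF _ _), lintegral_gaussianPDF_eq_one _ hv0,
    mul_one]

/-- If `e` is `1`-sub-Gaussian, then
`E exp (e b + e² q / 2) ≤ (1 - q)^(-1/2) exp (b² / (2 (1 - q)))`. -/
theorem lintegral_exp_quadratic_le {ν : Measure ℝ} [SFinite ν]
    (hν : HasSubgaussianMGF (fun e : ℝ => e) 1 ν) (b q : ℝ) (hq : 0 ≤ q) (hq1 : q < 1) :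
    ∫⁻ e, ENNReal.ofReal (Real.exp (e * b + e ^ 2 * (q / 2))) ∂ν ≤
      ENNReal.ofReal ((√(1 - q))⁻¹ * Real.exp (b ^ 2 / (2 * (1 - q)))) := by
  -- The quadratic term is linearized by an auxiliary standard Gaussian g: exp(e²q/2) = E exp(√q e
  -- g). After swapping the integrals, only the exponential moments of e are needed.
  have h : ∀ e : ℝ, ENNReal.ofReal (Real.exp (e * b + e ^ 2 * (q / 2))) =
      ∫⁻ g, ENNReal.ofReal (Real.exp ((b + √q * g) * e)) ∂(gaussianReal 0 1) := fun e => by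
    have h1 : ∀ g : ℝ, ENNReal.ofReal (Real.exp ((b + √q * g) * e)) =
        ENNReal.ofReal (Real.exp (e * b)) * ENNReal.ofReal (Real.exp (√q * e * g)) := fun g => by
      rw [← ENNReal.ofReal_mul (Real.exp_pos _).le, ← Real.exp_add]
      ring_nf
    simp_rw [h1]
    rw [lintegral_const_mul _ (by fun_prop), lintegral_exp_mul_gaussian,
      ← ENNReal.ofReal_mul (Real.exp_pos _).le, ← Real.exp_add, mul_pow, Real.sq_sqrt hq]
    ring_nf
  simp_rw [h]
  rw [lintegral_lintegral_swap (by fun_prop), ← lintegral_exp_sq_gaussian b q hq hq1]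
  exact lintegral_mono fun g => lintegral_exp_mul_le hν _

end StrategicBandit

namespace StrategicBandit

variable {d K : ℕ}

/-! ## The law of the interaction -/

instance instMarkovNature (env : Environment d K) (t : ℕ) : IsMarkovKernel (env.nature t) :=
  env.nature_markov t

instance instMarkovNoise (env : Environment d K) (t : ℕ) : IsMarkovKernel (env.noise t) :=
  env.noise_markov t

instance instMarkovSelect (M : Algorithm d K) (t : ℕ) : IsMarkovKernel (M.select t) :=
  M.markov t

instance instMarkovPlay (M : Algorithm d K) (t : ℕ) : IsMarkovKernel (M.play t) := by
  unfold Algorithm.play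
  infer_instance

instance instMarkovJointReport (σ : Fin K → Strategy d K) (t : ℕ) :
    IsMarkovKernel (jointReport σ t) where
  isProbabilityMeasure p := by
    have : ∀ i, IsMarkovKernel ((σ i).report t) := fun i => (σ i).markov t
    change IsProbabilityMeasure (Measure.pi fun i => (σ i).report t p)
    infer_instance

theorem measurable_mkRound (θ : Vec d) : Measurable (mkRound (K := K) θ) := by
  have h : Measurable fun q : ((Contexts d K × Contexts d K) × Play K) × ℝ =>
      (match q.1.2 with
        | some i => meanReward θ q.1.1.1 (some i) + q.2
        | none => 0 : ℝ) := by
    have h' : Measurable fun p : Play K × ((Contexts d K × Contexts d K) × ℝ) =>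
        (match p.1 with
          | some i => meanReward θ p.2.1.1 (some i) + p.2.2
          | none => 0 : ℝ) := by
      refine measurable_from_prod_countable_right fun a => ?_
      cases a with
      | none => exact measurable_const
      | some i =>
        simp only [meanReward]
        fun_prop
    exact h'.comp (by fun_prop :
      Measurable fun q : ((Contexts d K × Contexts d K) × Play K) × ℝ => (q.1.2, (q.1.1, q.2)))
  unfold mkRound
  exact (measurable_fst.comp (measurable_fst.comp measurable_fst)).prodMk
    ((measurable_snd.comp (measurable_fst.comp measurable_fst)).prodMk
      ((measurable_snd.comp measurable_fst).prodMk h))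

instance instMarkovRound (env : Environment d K) (M : Algorithm d K) (σ : Fin K → Strategy d K)
    (t : ℕ) : IsMarkovKernel (roundKernel env M σ t) := by
  unfold roundKernel
  exact Kernel.IsMarkovKernel.map _ (measurable_mkRound _)

theorem measurable_snoc (t : ℕ) :
    Measurable fun p : Hist d K t × Round d K => (Fin.snoc p.1 p.2 : Hist d K (t + 1)) := by
  refine measurable_pi_lambda _ fun s => ?_
  refine Fin.lastCases ?_ (fun s => ?_) s
  · simpa using measurable_snd
  · simpa using (by fun_prop : Measurable fun p : Hist d K t × Round d K => p.1 s)

theorem Measurable.comp_snoc {t : ℕ} {β : Type*} [MeasurableSpace β] {f : Hist d K (t + 1) → β}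
    (hf : Measurable f) (h : Hist d K t) : Measurable fun r : Round d K => f (Fin.snoc h r) :=
  hf.comp ((measurable_snoc t).comp measurable_prodMk_left)

theorem prefixHist_self {α : Type} {t : ℕ} (h : Fin t → α) : prefixHist h t le_rfl = h := rfl

theorem prefixHist_snoc {α : Type} {t : ℕ} (h : Fin t → α) (r : α) (s : ℕ) (hs : s ≤ t) :
    prefixHist (Fin.snoc h r : Fin (t + 1) → α) s (hs.trans t.le_succ) = prefixHist h s hs :=
  funext fun j => by
    have : Fin.castLE (hs.trans t.le_succ) j = (Fin.castLE hs j).castSucc := rfl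
    simp only [prefixHist, this, Fin.snoc_castSucc]

theorem measurable_prefixHist {α : Type} [MeasurableSpace α] {t s : ℕ} (hs : s ≤ t) :
    Measurable fun h : Fin t → α => prefixHist h s hs :=
  measurable_pi_lambda _ fun _ => measurable_pi_apply _

instance instProbabilityLaw (env : Environment d K) (M : Algorithm d K)
    (σ : Fin K → Strategy d K) (t : ℕ) : IsProbabilityMeasure (law env M σ t) := by
  induction t with
  | zero => exact Measure.dirac.isProbabilityMeasure
  | succ t ih => exact Measure.isProbabilityMeasure_map (measurable_snoc t).aemeasurable

section Law

variable (env : Environment d K) (M : Algorithm d K) (σ : Fin K → Strategy d K)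

theorem lintegral_law_succ {t : ℕ} {f : Hist d K (t + 1) → ENNReal} (hf : Measurable f) :
    ∫⁻ h, f h ∂(law env M σ (t + 1)) =
      ∫⁻ h, ∫⁻ r, f (Fin.snoc h r) ∂(roundKernel env M σ t h) ∂(law env M σ t) := by
  rw [law, lintegral_map hf (measurable_snoc t),
    Measure.lintegral_compProd (f := fun p => f (Fin.snoc p.1 p.2)) (hf.comp (measurable_snoc t))]

theorem lintegral_roundKernel {t : ℕ} (h : Hist d K t) {f : Round d K → ENNReal}
    (hf : Measurable f) :
    ∫⁻ r, f r ∂(roundKernel env M σ t h) =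
      ∫⁻ p, ∫⁻ a, ∫⁻ e, f (mkRound env.theta ((p, a), e)) ∂(env.noise t (h, (p, a)))
        ∂(M.play t (h, p)) ∂((env.nature t ⊗ₖ jointReport σ t) h) := by
  have hm : Measurable fun q => f (mkRound (K := K) env.theta q) := hf.comp (measurable_mkRound _)
  rw [roundKernel, Kernel.map_apply _ (measurable_mkRound _), lintegral_map hf (measurable_mkRound _),
    Kernel.lintegral_compProd _ _ _ hm, Kernel.lintegral_compProd]
  exact Measurable.lintegral_kernel_prod_right' (κ := (env.noise t).comap
      (fun q => (h, q)) measurable_prodMk_left) hm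

theorem ae_roundKernel_contexts {t : ℕ} (h : Hist d K t) {p : Contexts d K → Prop}
    (hp : MeasurableSet {x | p x}) (hx : ∀ᵐ x ∂(env.nature t h), p x) :
    ∀ᵐ r ∂(roundKernel env M σ t h), p r.1 := by
  rw [roundKernel, Kernel.map_apply _ (measurable_mkRound _),
    ae_map_iff (p := fun r => p r.1) (measurable_mkRound _).aemeasurable (measurable_fst hp)]
  have h₁ : ∀ᵐ y ∂((env.nature t ⊗ₖ jointReport σ t) h), p y.1 :=
    Kernel.ae_compProd_of_ae_ae (measurable_fst hp) (hx.mono fun x hx => ae_of_all _ fun _ => hx)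
  have h₂ : ∀ᵐ y ∂(((env.nature t ⊗ₖ jointReport σ t) ⊗ₖ M.play t) h), p y.1.1 :=
    Kernel.ae_compProd_of_ae_ae ((measurable_fst.comp measurable_fst) hp)
      (h₁.mono fun x hx => ae_of_all _ fun _ => hx)
  exact Kernel.ae_compProd_of_ae_ae
    ((measurable_fst.comp (measurable_fst.comp measurable_fst)) hp)
    (h₂.mono fun x hx => ae_of_all _ fun _ => hx)

/-! ### Almost sure properties of plays and rounds -/

theorem ae_measure_singleton_ne_zero {α : Type*} [MeasurableSpace α] [Countable α]
    (μ : Measure α) : ∀ᵐ a ∂μ, μ {a} ≠ 0 := by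
  have : {a | ¬ μ {a} ≠ 0} = ⋃ a ∈ {a | μ {a} = 0}, {a} := by ext; simp
  rw [ae_iff, this]
  exact (measure_biUnion_null_iff (Set.to_countable _)).2 fun a ha => ha

theorem measurable_kernel_singleton {α β : Type*} [MeasurableSpace α] [MeasurableSpace β]
    [Countable β] [DiscreteMeasurableSpace β] (κ : Kernel α β) :
    Measurable fun p : α × β => κ p.1 {p.2} := by
  have : Measurable fun p : β × α => κ p.2 {p.1} :=
    measurable_from_prod_countable_right fun b => κ.measurable_coe (measurableSet_singleton b)
  exact this.comp measurable_swap

instance instDiscretePlay (K : ℕ) : DiscreteMeasurableSpace (Option (Fin K)) :=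
  ⟨fun _ => trivial⟩

/-- A measurable substitute for membership in `optGTMChoices`: a play of positive conditional mass
must lie in every set of full conditional measure, so measurability of the argmax condition is never
needed. -/
theorem measurableSet_select_ne_zero (t : ℕ) :
    MeasurableSet {p : Hist d K t × Round d K |
      M.select t (obsHist p.1, p.2.2.report) {p.2.2.arm} ≠ 0} := by
  have : Measurable fun p : Hist d K t × Round d K =>
      M.select t (obsHist p.1, p.2.2.report) {p.2.2.arm} :=
    (measurable_kernel_singleton (M.select t)).comp
      (((measurable_obsHist.comp measurable_fst).prodMk
        (by unfold ObsRound.report; fun_prop)).prodMk (by change Measurable fun p : Hist d K t × Round d K => p.2.2.2.1; fun_prop))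
  exact (this (measurableSet_singleton 0)).compl

theorem ae_roundKernel_select {t : ℕ} (h : Hist d K t) :
    ∀ᵐ r ∂(roundKernel env M σ t h), M.select t (obsHist h, r.2.report) {r.2.arm} ≠ 0 := by
  have hm : MeasurableSet {r : Round d K |
      M.select t (obsHist h, r.2.report) {r.2.arm} ≠ 0} :=
    (measurableSet_select_ne_zero M t).preimage measurable_prodMk_left
  rw [roundKernel, Kernel.map_apply _ (measurable_mkRound _),
    ae_map_iff (measurable_mkRound _).aemeasurable hm]
  refine Kernel.ae_compProd_of_ae_ae (hm.preimage (measurable_mkRound _)) ?_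
  have hm' : MeasurableSet {q : (Contexts d K × Contexts d K) × Play K |
      M.select t (obsHist h, q.1.2) {q.2} ≠ 0} :=
    hm.preimage ((measurable_mkRound 0).comp
      (measurable_id.prodMk (measurable_const (a := (0 : ℝ)))))
  have := Kernel.ae_compProd_of_ae_ae (κ := env.nature t ⊗ₖ jointReport σ t) (η := M.play t)
    (a := h) hm' (ae_of_all _ fun p => ae_measure_singleton_ne_zero (M.select t (obsHist h, p.2)))
  filter_upwards [this] with q hq
  exact ae_of_all _ fun _ => hq

/-- Induction on the horizon: the last round is handled by its conditional law, and appending it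
leaves the earlier prefixes unchanged. -/
theorem ae_law_of_ae_roundKernel {Q : ∀ t, Hist d K t → Round d K → Prop}
    (hQm : ∀ t, MeasurableSet {p : Hist d K t × Round d K | Q t p.1 p.2})
    (hQ : ∀ t h, ∀ᵐ r ∂(roundKernel env M σ t h), Q t h r) (T : ℕ) :
    ∀ᵐ h ∂(law env M σ T), ∀ s : Fin T, Q s (prefixHist h s s.isLt.le) (h s) := by
  have hms : ∀ T, MeasurableSet
      {h : Hist d K T | ∀ s : Fin T, Q s (prefixHist h s s.isLt.le) (h s)} := fun T => by
    rw [Set.ofPred_forall]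
    exact MeasurableSet.iInter fun s => (hQm s).preimage
      ((measurable_prefixHist s.isLt.le).prodMk (measurable_pi_apply s))
  induction T with
  | zero => exact ae_of_all _ fun h s => s.elim0
  | succ t ih =>
    rw [law, ae_map_iff (measurable_snoc t).aemeasurable (hms _)]
    refine Measure.ae_compProd_of_ae_ae ((hms _).preimage (measurable_snoc t)) ?_
    filter_upwards [ih] with h hh
    filter_upwards [hQ t h] with r hr s
    refine Fin.lastCases ?_ (fun s => ?_) s
    · simpa [prefixHist_snoc h r t le_rfl, prefixHist_self] using hr
    · simpa [prefixHist_snoc h r s s.isLt.le] using hh s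

/-! ## Supermartingales along the interaction -/

/-- A nonnegative process on histories that does not increase in conditional expectation. -/
structure IsSupermart (W : ∀ t, Hist d K t → ENNReal) : Prop where
  measurable : ∀ t, Measurable (W t)
  step : ∀ t h, ∫⁻ r, W (t + 1) (Fin.snoc h r) ∂(roundKernel env M σ t h) ≤ W t h

variable {env M σ}

theorem IsSupermart.add {W₁ W₂ : ∀ t, Hist d K t → ENNReal} (h₁ : IsSupermart env M σ W₁)
    (h₂ : IsSupermart env M σ W₂) : IsSupermart env M σ fun t h => W₁ t h + W₂ t h where
  measurable t := (h₁.measurable t).add (h₂.measurable t)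
  step t h := by
    rw [lintegral_add_left (Measurable.comp_snoc (h₁.measurable _) h)]
    exact add_le_add (h₁.step t h) (h₂.step t h)

theorem IsSupermart.sum {ι : Type*} (s : Finset ι) {W : ι → ∀ t, Hist d K t → ENNReal}
    (hW : ∀ j ∈ s, IsSupermart env M σ (W j)) :
    IsSupermart env M σ fun t h => ∑ j ∈ s, W j t h where
  measurable t := Finset.measurable_fun_sum _ fun j hj => (hW j hj).measurable t
  step t h := by
    rw [lintegral_finsetSum' _
      fun j hj => (Measurable.comp_snoc ((hW j hj).measurable _) h).aemeasurable]
    exact Finset.sum_le_sum fun j hj => (hW j hj).step t h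

theorem IsSupermart.const_mul {W : ∀ t, Hist d K t → ENNReal} (hW : IsSupermart env M σ W)
    (c : ENNReal) : IsSupermart env M σ fun t h => c * W t h where
  measurable t := (hW.measurable t).const_mul c
  step t h := by
    rw [lintegral_const_mul _ (Measurable.comp_snoc (hW.measurable _) h)]
    gcongr
    exact hW.step t h

/-- It suffices to integrate over the noise with contexts, reports and play held fixed. This is why
nature, the arms and the tie-breaking may be arbitrary. -/
theorem isSupermart_of_noise {W : ∀ t, Hist d K t → ENNReal} (hm : ∀ t, Measurable (W t))
    (hW : ∀ t h p a, ∫⁻ e, W (t + 1) (Fin.snoc h (mkRound env.theta ((p, a), e)))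
      ∂(env.noise t (h, (p, a))) ≤ W t h) : IsSupermart env M σ W where
  measurable := hm
  step t h := by
    rw [lintegral_roundKernel env M σ h (Measurable.comp_snoc (hm _) h)]
    calc _ ≤ ∫⁻ p, ∫⁻ a, W t h ∂(M.play t (h, p)) ∂((env.nature t ⊗ₖ jointReport σ t) h) :=
          lintegral_mono fun p => lintegral_mono fun a => hW t h p a
      _ = W t h := by simp

theorem measurableSet_crossing {W : ∀ t, Hist d K t → ENNReal} (hm : ∀ t, Measurable (W t))
    (a : ENNReal) (t : ℕ) :
    MeasurableSet {h : Hist d K t | ∃ (s : ℕ) (hs : s ≤ t), a ≤ W s (prefixHist h s hs)} := by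
  simp only [Set.ofPred_exists]
  exact MeasurableSet.iUnion fun s => MeasurableSet.iUnion fun hs =>
    ((hm s).comp (measurable_prefixHist hs)) measurableSet_Ici

/-- Ville's inequality. -/
theorem IsSupermart.ville {W : ∀ t, Hist d K t → ENNReal} (hW : IsSupermart env M σ W)
    (a : ENNReal) (T : ℕ) :
    a * law env M σ T {h | ∃ (s : ℕ) (hs : s ≤ T), a ≤ W s (prefixHist h s hs)} ≤
      W 0 Fin.elim0 := by
  classical
  let X : ∀ t, Set (Hist d K t) := fun t => {h | ∃ (s : ℕ) (hs : s ≤ t), a ≤ W s (prefixHist h s hs)}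
  have hX : ∀ t, MeasurableSet (X t) := measurableSet_crossing hW.measurable a
  -- The process frozen at the level `a` from the first crossing on. Its expectation does not
  -- increase, and on the crossing event it equals `a`.
  let F : ∀ t, Hist d K t → ENNReal := fun t => (X t).piecewise (fun _ => a) (W t)
  have hF : ∀ t, Measurable (F t) := fun t => measurable_const.piecewise (hX t) (hW.measurable t)
  have hstep : ∀ t h, ∫⁻ r, F (t + 1) (Fin.snoc h r) ∂(roundKernel env M σ t h) ≤ F t h := by
    intro t h
    by_cases hh : h ∈ X t
    · have : ∀ r, F (t + 1) (Fin.snoc h r) = a := fun r => by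
        refine Set.piecewise_eq_of_mem _ _ _ ?_
        obtain ⟨s, hs, hle⟩ := hh
        exact ⟨s, hs.trans t.le_succ, by rwa [prefixHist_snoc h r s hs]⟩
      simp [this, F, hh]
    · have h1 : F t h = W t h := Set.piecewise_eq_of_notMem _ _ _ hh
      rw [h1]
      refine (lintegral_mono fun r => ?_).trans (hW.step t h)
      by_cases hr : (Fin.snoc h r : Hist d K (t + 1)) ∈ X (t + 1)
      · have h2 : F (t + 1) (Fin.snoc h r) = a := Set.piecewise_eq_of_mem _ _ _ hr
        rw [h2]
        obtain ⟨s, hs, hle⟩ := hr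
        -- A crossing absent before must happen in the new round, where the frozen value `a` is at
        -- most the value of `W`.
        rcases Nat.lt_or_ge t s with hlt | hge
        · obtain rfl : s = t + 1 := by omega
          exact hle
        · rw [prefixHist_snoc h r s hge] at hle
          exact (hh ⟨s, hge, hle⟩).elim
      · exact (Set.piecewise_eq_of_notMem _ _ _ hr).le
  have hint : ∀ t, ∫⁻ h, F t h ∂(law env M σ t) ≤ W 0 Fin.elim0 := by
    intro t
    induction t with
    | zero =>
      rw [law, lintegral_dirac' _ (hF 0)]
      by_cases hh : (Fin.elim0 : Hist d K 0) ∈ X 0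
      · obtain ⟨s, hs, hle⟩ := hh
        obtain rfl : s = 0 := by omega
        have h2 : F 0 Fin.elim0 = a := Set.piecewise_eq_of_mem _ _ _ ⟨0, hs, hle⟩
        rw [h2]
        convert hle
      · exact (Set.piecewise_eq_of_notMem _ _ _ hh).le
    | succ t ih =>
      rw [lintegral_law_succ env M σ (hF _)]
      exact (lintegral_mono fun h => hstep t h).trans ih
  refine le_trans ?_ (hint T)
  rw [← setLIntegral_const]
  refine (setLIntegral_mono' (hX T) fun h hh => ?_).trans (setLIntegral_le_lintegral (X T) _)
  exact (Set.piecewise_eq_of_mem (X T) (fun _ => a) (W T) hh).ge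

end Law

end StrategicBandit

namespace StrategicBandit

variable {d K : ℕ}

/-! ## Recursion over the rounds -/

theorem sum_pullRounds_succ {α : Type*} [AddCommMonoid α] {t : ℕ} (h : ObsHist d K (t + 1))
    (i : Fin K) (f : Fin (t + 1) → α) :
    ∑ l ∈ pullRounds h i, f l =
      ∑ l ∈ pullRounds (prefixHist h t t.le_succ) i, f l.castSucc +
        if (h (Fin.last t)).arm = some i then f (Fin.last t) else 0 := by
  simp only [pullRounds, Finset.sum_filter]
  rw [Fin.sum_univ_castSucc]
  rfl

theorem pulls_succ {t : ℕ} (h : ObsHist d K (t + 1)) (i : Fin K) :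
    pulls h i = pulls (prefixHist h t t.le_succ) i +
      if (h (Fin.last t)).arm = some i then 1 else 0 := by
  simpa only [pulls, Finset.card_eq_sum_ones] using sum_pullRounds_succ h i fun _ => 1

theorem covMatrix_succ (lam : ℝ) {t : ℕ} (h : ObsHist d K (t + 1)) (i : Fin K) :
    covMatrix lam h i = covMatrix lam (prefixHist h t t.le_succ) i +
      if (h (Fin.last t)).arm = some i then
        Matrix.vecMulVec ((h (Fin.last t)).report i).ofLp ((h (Fin.last t)).report i).ofLp
      else 0 := by
  rw [covMatrix, sum_pullRounds_succ, ← add_assoc]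
  rfl

theorem pulls_le {t : ℕ} (h : ObsHist d K t) (i : Fin K) : pulls h i ≤ t := by
  simpa [pulls] using Finset.card_le_univ (pullRounds h i)

theorem posDef_covMatrix {lam : ℝ} (hlam : 0 < lam) {t : ℕ} (h : ObsHist d K t) (i : Fin K) :
    (covMatrix lam h i).PosDef := by
  refine (Matrix.PosDef.one.smul hlam).add_posSemidef (Matrix.posSemidef_sum _ fun l _ => ?_)
  simpa using Matrix.posSemidef_vecMulVec_self_star (ObsRound.report (h l) i).ofLp

theorem quadForm_covMatrix (lam : ℝ) {t : ℕ} (h : ObsHist d K t) (i : Fin K) (y : Fin d → ℝ) :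
    y ⬝ᵥ (covMatrix lam h i *ᵥ y) =
      lam * (y ⬝ᵥ y) + ∑ l ∈ pullRounds h i, ((ObsRound.report (h l) i).ofLp ⬝ᵥ y) ^ 2 := by
  rw [covMatrix, Matrix.add_mulVec, Matrix.smul_mulVec, Matrix.one_mulVec, Matrix.sum_mulVec,
    dotProduct_add, dotProduct_smul, smul_eq_mul, dotProduct_sum]
  congr 1
  refine Finset.sum_congr rfl fun l _ => ?_
  rw [Matrix.vecMulVec_mulVec, op_smul_eq_smul, dotProduct_smul, smul_eq_mul, sq,
    dotProduct_comm y]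

theorem det_covMatrix_zero (lam : ℝ) (h : ObsHist d K 0) (i : Fin K) :
    (covMatrix lam h i).det = lam ^ d := by
  simp [covMatrix, pullRounds]

/-! ## The noise processes -/

/-- The noise of a round in which arm `i` is played. -/
noncomputable def eta (θ : Vec d) (i : Fin K) (r : Round d K) : ℝ := r.2.reward - inner ℝ θ (r.1 i)

/-- The sum of the reports of arm `i` in the rounds it was played, weighted by the noise. -/
noncomputable def noiseVec (θ : Vec d) {t : ℕ} (h : Hist d K t) (i : Fin K) : Fin d → ℝ :=
  ∑ l ∈ pullRounds (obsHist h) i, eta θ i (h l) • (ObsRound.report (h l).2 i).ofLp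

/-- The sum of the noise in the rounds in which arm `i` was played. -/
noncomputable def noiseSum (θ : Vec d) {t : ℕ} (h : Hist d K t) (i : Fin K) : ℝ :=
  ∑ l ∈ pullRounds (obsHist h) i, eta θ i (h l)

/-- The self-normalized process `√(det (lam I) / det V) exp (‖S‖² / 2)`, where `S` is the noise
vector of arm `i` and the norm is weighted by `V⁻¹`. -/
noncomputable def selfNormProcess (lam : ℝ) (θ : Vec d) (i : Fin K) {t : ℕ} (h : Hist d K t) : ℝ :=
  √(lam ^ d / (covMatrix lam (obsHist h) i).det) *
    Real.exp (noiseVec θ h i ⬝ᵥ ((covMatrix lam (obsHist h) i)⁻¹ *ᵥ noiseVec θ h i) / 2)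

/-- The exponential process `exp (s N - s² n / 2)`, where `N` is the sum of the noise of arm `i` and
`n` the number of its pulls. -/
noncomputable def expProcess (s : ℝ) (θ : Vec d) (i : Fin K) {t : ℕ} (h : Hist d K t) : ℝ :=
  Real.exp (s * noiseSum θ h i - s ^ 2 / 2 * pulls (obsHist h) i)

/-! ### Measurability of the noise processes -/

theorem measurable_sum_pullRounds {t : ℕ} (i : Fin K) {f : Fin t → Hist d K t → ℝ}
    (hf : ∀ l, Measurable (f l)) :
    Measurable fun h : Hist d K t => ∑ l ∈ pullRounds (obsHist h) i, f l h := by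
  simp only [pullRounds, Finset.sum_filter]
  refine Finset.measurable_fun_sum _ fun l _ => Measurable.ite ?_ (hf l) measurable_const
  have : Measurable fun h : Hist d K t => (h l).2.2.1 := by fun_prop
  exact this (measurableSet_singleton (some i))

theorem measurable_eta (θ : Vec d) (i : Fin K) : Measurable (eta θ i) := by
  unfold eta ObsRound.reward
  fun_prop

theorem measurable_covMatrix (lam : ℝ) (t : ℕ) (i : Fin K) (a b : Fin d) :
    Measurable fun h : Hist d K t => covMatrix lam (obsHist h) i a b := by
  simp only [covMatrix, Matrix.add_apply, Matrix.sum_apply, Matrix.vecMulVec_apply]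
  refine measurable_const.add (measurable_sum_pullRounds i fun l => ?_)
  unfold ObsRound.report obsHist
  fun_prop

theorem measurable_noiseVec (θ : Vec d) (t : ℕ) (i : Fin K) (a : Fin d) :
    Measurable fun h : Hist d K t => noiseVec θ h i a := by
  simp only [noiseVec, Finset.sum_apply, Pi.smul_apply, smul_eq_mul]
  refine measurable_sum_pullRounds i fun l => ?_
  refine ((measurable_eta θ i).comp (measurable_pi_apply l)).mul ?_
  unfold ObsRound.report
  fun_prop

theorem measurable_selfNormProcess (lam : ℝ) (θ : Vec d) (i : Fin K) (t : ℕ) :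
    Measurable (selfNormProcess lam θ i (t := t)) := by
  have hV := measurable_covMatrix (d := d) (K := K) lam t i
  have hS := measurable_noiseVec (K := K) θ t i
  refine (measurable_const.div (measurable_matrix_det hV)).sqrt.mul
    ((measurable_dotProduct hS fun a => ?_).div_const 2).exp
  exact measurable_dotProduct (measurable_matrix_inv hV a) hS

theorem measurable_expProcess (s : ℝ) (θ : Vec d) (i : Fin K) (t : ℕ) :
    Measurable (expProcess s θ i (t := t)) := by
  have h₁ : Measurable fun h : Hist d K t => noiseSum θ h i :=
    measurable_sum_pullRounds i fun l => (measurable_eta θ i).comp (measurable_pi_apply l)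
  have h₂ : Measurable fun h : Hist d K t => (pulls (obsHist h) i : ℝ) := by
    have := measurable_sum_pullRounds (d := d) (t := t) i (f := fun _ _ => 1)
      fun _ => measurable_const
    simpa [pulls] using this
  exact ((h₁.const_mul s).sub (h₂.const_mul _)).exp

/-! ### One-round updates and the supermartingale property -/

theorem obsHist_snoc_last {t : ℕ} (h : Hist d K t) (r : Round d K) :
    obsHist (Fin.snoc h r : Hist d K (t + 1)) (Fin.last t) = r.2 := by
  simp [obsHist]

theorem prefixHist_obsHist_snoc {t : ℕ} (h : Hist d K t) (r : Round d K) :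
    prefixHist (obsHist (Fin.snoc h r : Hist d K (t + 1))) t t.le_succ = obsHist h := by
  change obsHist (prefixHist (Fin.snoc h r : Hist d K (t + 1)) t t.le_succ) = _
  rw [prefixHist_snoc h r t le_rfl, prefixHist_self]

theorem noiseVec_snoc (θ : Vec d) {t : ℕ} (h : Hist d K t) (r : Round d K) (i : Fin K) :
    noiseVec θ (Fin.snoc h r : Hist d K (t + 1)) i = noiseVec θ h i +
      if r.2.arm = some i then eta θ i r • (r.2.report i).ofLp else 0 := by
  rw [noiseVec, sum_pullRounds_succ, prefixHist_obsHist_snoc, obsHist_snoc_last]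
  simp [noiseVec]

theorem noiseSum_snoc (θ : Vec d) {t : ℕ} (h : Hist d K t) (r : Round d K) (i : Fin K) :
    noiseSum θ (Fin.snoc h r : Hist d K (t + 1)) i = noiseSum θ h i +
      if r.2.arm = some i then eta θ i r else 0 := by
  rw [noiseSum, sum_pullRounds_succ, prefixHist_obsHist_snoc, obsHist_snoc_last]
  simp [noiseSum]

theorem covMatrix_snoc (lam : ℝ) {t : ℕ} (h : Hist d K t) (r : Round d K) (i : Fin K) :
    covMatrix lam (obsHist (Fin.snoc h r : Hist d K (t + 1))) i = covMatrix lam (obsHist h) i +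
      if r.2.arm = some i then Matrix.vecMulVec (r.2.report i).ofLp (r.2.report i).ofLp else 0 := by
  rw [covMatrix_succ, prefixHist_obsHist_snoc, obsHist_snoc_last]

theorem pulls_snoc {t : ℕ} (h : Hist d K t) (r : Round d K) (i : Fin K) :
    pulls (obsHist (Fin.snoc h r : Hist d K (t + 1))) i = pulls (obsHist h) i +
      if r.2.arm = some i then 1 else 0 := by
  rw [pulls_succ, prefixHist_obsHist_snoc, obsHist_snoc_last]

theorem arm_mkRound (θ : Vec d) (p : Contexts d K × Contexts d K) (a : Play K) (e : ℝ) :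
    (mkRound θ ((p, a), e)).2.arm = a := rfl

theorem report_mkRound (θ : Vec d) (p : Contexts d K × Contexts d K) (a : Play K) (e : ℝ) :
    (mkRound θ ((p, a), e)).2.report = p.2 := rfl

theorem eta_mkRound (θ : Vec d) (p : Contexts d K × Contexts d K) (i : Fin K) (e : ℝ) :
    eta θ i (mkRound θ ((p, some i), e)) = e := by
  simp [eta, mkRound, ObsRound.reward, meanReward]

/-- If arm `i` is played with w = ‖x‖² in the V⁻¹ norm, the determinant factor shrinks by √(1 + w).
The scalar moment bound with q = w/(1 + w) gives back exactly √(1 + w), and its exponent cancels the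
negative term of the Sherman-Morrison update. Otherwise nothing changes. -/
theorem isSupermart_selfNormProcess {env : Environment d K} {S : ℝ} (hreg : env.Regular S)
    (M : Algorithm d K) (σ : Fin K → Strategy d K) {lam : ℝ} (hlam : 0 < lam) (i : Fin K) :
    IsSupermart env M σ fun _ h => ENNReal.ofReal (selfNormProcess lam env.theta i h) := by
  refine isSupermart_of_noise
    (fun t => (measurable_selfNormProcess lam env.theta i t).ennreal_ofReal) fun t h p a => ?_
  by_cases ha : a = some i
  · subst ha
    have hV := posDef_covMatrix hlam (obsHist h) i
    simp only [selfNormProcess, noiseVec_snoc, covMatrix_snoc, arm_mkRound, report_mkRound,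
      eta_mkRound, if_true, det_add_vecMulVec hV, quadForm_inv_add_vecMulVec hV]
    set V := covMatrix lam (obsHist h) i
    set x := (p.2 i).ofLp
    set s := noiseVec env.theta h i
    set w := x ⬝ᵥ (V⁻¹ *ᵥ x)
    set a := x ⬝ᵥ (V⁻¹ *ᵥ s)
    set q := s ⬝ᵥ (V⁻¹ *ᵥ s)
    have hw : 0 ≤ w := dotProduct_inv_mulVec_nonneg hV x
    have hdet : 0 < V.det := hV.det_pos
    -- Only the second factor depends on the fresh noise `e`.
    have hfac : ∀ e : ℝ, ENNReal.ofReal (√(lam ^ d / (V.det * (1 + w))) *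
        Real.exp ((q - a ^ 2 / (1 + w) + 2 * (e * (a / (1 + w)) + e ^ 2 * (w / (1 + w) / 2))) / 2))
        = ENNReal.ofReal (√(lam ^ d / (V.det * (1 + w))) * Real.exp ((q - a ^ 2 / (1 + w)) / 2)) *
          ENNReal.ofReal (Real.exp (e * (a / (1 + w)) + e ^ 2 * (w / (1 + w) / 2))) := fun e => by
      rw [← ENNReal.ofReal_mul (by positivity), mul_assoc, ← Real.exp_add]
      ring_nf
    simp_rw [hfac]
    rw [lintegral_const_mul _ (by fun_prop)]
    have hρ : 1 - w / (1 + w) = (1 + w)⁻¹ := by field_simp; ring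
    have hρ1 : w / (1 + w) < 1 := by rw [div_lt_one (by positivity)]; linarith
    refine (mul_le_mul_right (lintegral_exp_quadratic_le (hreg.noise_subGaussian t _)
      (a / (1 + w)) (w / (1 + w)) (by positivity) hρ1) _).trans ?_
    rw [← ENNReal.ofReal_mul (by positivity), hρ]
    refine ENNReal.ofReal_le_ofReal (le_of_eq ?_)
    have h1 : √(lam ^ d / (V.det * (1 + w))) = √(lam ^ d / V.det) * (√(1 + w))⁻¹ := by
      rw [← Real.sqrt_inv, ← Real.sqrt_mul (by positivity), ← div_div, div_eq_mul_inv _ (1 + w)]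
    have h2 : √(1 + w) ≠ 0 := by positivity
    have h3 : Real.exp (q / 2) = Real.exp ((q - a ^ 2 / (1 + w)) / 2) *
        Real.exp ((a / (1 + w)) ^ 2 / (2 * (1 + w)⁻¹)) := by
      rw [← Real.exp_add]
      congr 1
      field_simp
      ring
    rw [h1, h3, Real.sqrt_inv]
    field_simp
  · simp [selfNormProcess, noiseVec_snoc, covMatrix_snoc, arm_mkRound, ha]

/-- Each pull multiplies the process by exp(s e - s²/2), whose conditional mean is at most 1 by
sub-Gaussianity. -/
theorem isSupermart_expProcess {env : Environment d K} {S : ℝ} (hreg : env.Regular S)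
    (M : Algorithm d K) (σ : Fin K → Strategy d K) (s : ℝ) (i : Fin K) :
    IsSupermart env M σ fun _ h => ENNReal.ofReal (expProcess s env.theta i h) := by
  refine isSupermart_of_noise
    (fun t => (measurable_expProcess s env.theta i t).ennreal_ofReal) fun t h p a => ?_
  by_cases ha : a = some i
  · subst ha
    simp only [expProcess, noiseSum_snoc, pulls_snoc, arm_mkRound, eta_mkRound, if_true]
    have hfac : ∀ e : ℝ, ENNReal.ofReal (Real.exp (s * (noiseSum env.theta h i + e) -
        s ^ 2 / 2 * ((pulls (obsHist h) i + 1 : ℕ) : ℝ))) =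
        ENNReal.ofReal (Real.exp (s * noiseSum env.theta h i -
          s ^ 2 / 2 * (pulls (obsHist h) i : ℝ) - s ^ 2 / 2)) *
          ENNReal.ofReal (Real.exp (s * e)) := fun e => by
      rw [← ENNReal.ofReal_mul (by positivity), ← Real.exp_add]
      push_cast
      ring_nf
    simp_rw [hfac]
    rw [lintegral_const_mul _ (by fun_prop)]
    refine (mul_le_mul_right (lintegral_exp_mul_le (hreg.noise_subGaussian t _) s) _).trans ?_
    rw [← ENNReal.ofReal_mul (by positivity), ← Real.exp_add]
    ring_nf
    rfl
  · simp [expProcess, noiseSum_snoc, pulls_snoc, arm_mkRound, ha]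

end StrategicBandit

namespace StrategicBandit

variable {d K : ℕ}

/-! ## Confidence bounds along a history -/

/-- Reports of norm at most 1 add at most 1 per pull to the quadratic form on unit vectors. -/
theorem det_covMatrix_le {lam : ℝ} (hlam : 0 < lam) {t : ℕ} {h : ObsHist d K t} {i : Fin K}
    (hb : ∀ l, ‖ObsRound.report (h l) i‖ ≤ 1) :
    (covMatrix lam h i).det ≤ (lam + pulls h i) ^ d := by
  have := det_le_pow_of_quadForm_le (posDef_covMatrix hlam h i) (b := lam + pulls h i) fun y => by
    rw [quadForm_covMatrix, add_mul]
    gcongr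
    rw [pulls, ← nsmul_eq_mul]
    refine Finset.sum_le_card_nsmul _ _ _ fun l _ => ?_
    have h₁ := abs_real_inner_le_norm (ObsRound.report (h l) i) (WithLp.toLp 2 y)
    have h₂ : inner ℝ (ObsRound.report (h l) i) (WithLp.toLp 2 y) =
        (ObsRound.report (h l) i).ofLp ⬝ᵥ y := by
      simp [EuclideanSpace.inner_eq_star_dotProduct, dotProduct_comm]
    have h₃ : ‖WithLp.toLp 2 y‖ ^ 2 = y ⬝ᵥ y := by
      rw [← real_inner_self_eq_norm_sq, EuclideanSpace.inner_eq_star_dotProduct]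
      simp
    rw [← h₂, ← h₃, ← sq_abs]
    gcongr
    refine h₁.trans ?_
    simpa using mul_le_mul_of_nonneg_right (hb l) (norm_nonneg (WithLp.toLp 2 y))
  simpa using this

theorem log_det_covMatrix_le {lam : ℝ} (hlam : 0 < lam) {t : ℕ} {h : ObsHist d K t} {i : Fin K}
    (hb : ∀ l, ‖ObsRound.report (h l) i‖ ≤ 1) :
    Real.log ((covMatrix lam h i).det / lam ^ d) ≤ d * Real.log (1 + pulls h i / lam) := by
  have hdet : 0 < (covMatrix lam h i).det := (posDef_covMatrix hlam h i).det_pos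
  rw [← Real.log_pow]
  refine Real.log_le_log (by positivity) ?_
  have : 1 + (pulls h i : ℝ) / lam = (lam + pulls h i) / lam := by field_simp
  rw [this, div_pow]
  gcongr
  exact det_covMatrix_le hlam hb

theorem confRadius_eq {T : ℕ} (hT : 1 ≤ T) {lam : ℝ} (hlam : 0 < lam) (S : ℝ) {t : ℕ}
    (h : ObsHist d K t) (i : Fin K) :
    confRadius T lam S h i =
      √(d * (Real.log (1 + pulls h i / lam) + 2 * Real.log T)) + √lam * S := by
  have hT' : (0 : ℝ) < T := by exact_mod_cast hT
  rw [confRadius, div_div_eq_mul_div, div_one, Real.log_mul (by positivity) (by positivity),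
    Real.log_pow]
  norm_num

theorem dotProduct_eq_inner (x y : Vec d) : x.ofLp ⬝ᵥ y.ofLp = inner ℝ x y := by
  simp [EuclideanSpace.inner_eq_star_dotProduct, dotProduct_comm]

/-- The estimation error of the ridge regression estimator. -/
theorem thetaHat_eq {lam : ℝ} (hlam : 0 < lam) {θ θi : Vec d} {t : ℕ} {h : Hist d K t} {i : Fin K}
    (hreal : ∀ l, inner ℝ θ ((h l).1 i) = inner ℝ θi (ObsRound.report (h l).2 i)) :
    thetaHat lam (obsHist h) i =
      θi.ofLp + (covMatrix lam (obsHist h) i)⁻¹ *ᵥ (noiseVec θ h i - lam • θi.ofLp) := by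
  have hu : IsUnit (covMatrix lam (obsHist h) i).det :=
    (posDef_covMatrix hlam (obsHist h) i).det_pos.ne'.isUnit
  have h₁ : ∑ l ∈ pullRounds (obsHist h) i,
      ObsRound.reward (obsHist h l) • (ObsRound.report (obsHist h l) i).ofLp =
      noiseVec θ h i - lam • θi.ofLp + covMatrix lam (obsHist h) i *ᵥ θi.ofLp := by
    rw [covMatrix, Matrix.add_mulVec, Matrix.smul_mulVec, Matrix.one_mulVec, Matrix.sum_mulVec,
      ← add_assoc, sub_add_cancel, noiseVec, ← Finset.sum_add_distrib]
    refine Finset.sum_congr rfl fun l _ => ?_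
    rw [Matrix.vecMulVec_mulVec, op_smul_eq_smul]
    change (h l).2.reward • ((h l).2.report i).ofLp = eta θ i (h l) • ((h l).2.report i).ofLp +
      (((h l).2.report i).ofLp ⬝ᵥ θi.ofLp) • ((h l).2.report i).ofLp
    rw [← add_smul, dotProduct_eq_inner, real_inner_comm, eta, hreal l, sub_add_cancel]
  rw [thetaHat, h₁, Matrix.mulVec_add, Matrix.mulVec_mulVec, Matrix.nonsing_inv_mul _ hu,
    Matrix.one_mulVec, add_comm]

/-- Taking logarithms in the process bound gives ‖N‖² ≤ 2 log T + log(det V / lam^d) for the noise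
vector N. The threshold `T` thus matches δ = 1/T² in the confidence radius. -/
theorem sqrt_noiseVec_le {T : ℕ} (hT : 1 ≤ T) (hd : 1 ≤ d) {lam : ℝ} (hlam : 0 < lam) {θ : Vec d}
    {t : ℕ} {h : Hist d K t} {i : Fin K} (hb : ∀ l, ‖ObsRound.report (h l).2 i‖ ≤ 1)
    (hN : selfNormProcess lam θ i h < T) :
    √(noiseVec θ h i ⬝ᵥ ((covMatrix lam (obsHist h) i)⁻¹ *ᵥ noiseVec θ h i)) ≤
      √(d * (Real.log (1 + pulls (obsHist h) i / lam) + 2 * Real.log T)) := by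
  have hT' : (1 : ℝ) ≤ T := by exact_mod_cast hT
  have hdet : 0 < (covMatrix lam (obsHist h) i).det := (posDef_covMatrix hlam _ i).det_pos
  have hlog := log_det_covMatrix_le hlam (h := obsHist h) hb
  refine Real.sqrt_le_sqrt ?_
  rw [selfNormProcess] at hN
  have h₁ := Real.log_lt_log (by positivity) hN
  rw [Real.log_mul (by positivity) (by positivity), Real.log_exp, Real.log_sqrt (by positivity),
    ← inv_div (covMatrix lam (obsHist h) i).det, Real.log_inv] at h₁
  -- The radius carries log T² inside the factor `d`, which is more than needed once `d ≥ 1`.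
  have h₂ : Real.log T ≤ d * Real.log T :=
    le_mul_of_one_le_left (Real.log_nonneg hT') (by exact_mod_cast hd)
  linarith

/-- The confidence interval of arm `i` contains the mean reward. -/
theorem abs_thetaHat_sub_le {T : ℕ} (hT : 1 ≤ T) (hd : 1 ≤ d) {lam S : ℝ} (hlam : 0 < lam)
    {θ θi : Vec d} (hθi : ‖θi‖ ≤ S) {t : ℕ} {h : Hist d K t} {i : Fin K}
    (hb : ∀ l, ‖ObsRound.report (h l).2 i‖ ≤ 1)
    (hreal : ∀ l, inner ℝ θ ((h l).1 i) = inner ℝ θi (ObsRound.report (h l).2 i))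
    (hN : selfNormProcess lam θ i h < T) (x : Vec d) :
    |thetaHat lam (obsHist h) i ⬝ᵥ x.ofLp - inner ℝ θi x| ≤
      confRadius T lam S (obsHist h) i * invNorm lam (obsHist h) i x := by
  have hV := posDef_covMatrix hlam (obsHist h) i
  have hS : 0 ≤ S := (norm_nonneg _).trans hθi
  rw [confRadius_eq hT hlam, thetaHat_eq hlam hreal, add_dotProduct, dotProduct_eq_inner,
    add_sub_cancel_left, dotProduct_comm, Matrix.mulVec_sub, Matrix.mulVec_smul, dotProduct_sub,
    dotProduct_smul, smul_eq_mul, invNorm]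
  set V := covMatrix lam (obsHist h) i
  set N := noiseVec θ h i
  have h₁ : |x.ofLp ⬝ᵥ (V⁻¹ *ᵥ N)| ≤ √(x.ofLp ⬝ᵥ (V⁻¹ *ᵥ x.ofLp)) *
      √(d * (Real.log (1 + pulls (obsHist h) i / lam) + 2 * Real.log T)) :=
    (abs_dotProduct_inv_mulVec_le hV _ _).trans
      (mul_le_mul_of_nonneg_left (sqrt_noiseVec_le hT hd hlam hb hN) (Real.sqrt_nonneg _))
  have h₂ : √(θi.ofLp ⬝ᵥ (V⁻¹ *ᵥ θi.ofLp)) ≤ S / √lam := by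
    have h₃ := dotProduct_inv_mulVec_le hV hlam (fun y => by
      rw [quadForm_covMatrix]
      exact le_add_of_nonneg_right (Finset.sum_nonneg fun _ _ => sq_nonneg _)) θi.ofLp
    rw [dotProduct_eq_inner θi θi, real_inner_self_eq_norm_sq] at h₃
    refine (Real.sqrt_le_sqrt h₃).trans ?_
    rw [Real.sqrt_div (by positivity), Real.sqrt_sq (norm_nonneg _)]
    gcongr
  have h₄ : |lam * (x.ofLp ⬝ᵥ (V⁻¹ *ᵥ θi.ofLp))| ≤
      √(x.ofLp ⬝ᵥ (V⁻¹ *ᵥ x.ofLp)) * (√lam * S) := by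
    rw [abs_mul, abs_of_pos hlam]
    calc _ ≤ lam * (√(x.ofLp ⬝ᵥ (V⁻¹ *ᵥ x.ofLp)) * (S / √lam)) := by
          gcongr
          exact (abs_dotProduct_inv_mulVec_le hV _ _).trans
            (mul_le_mul_of_nonneg_left h₂ (Real.sqrt_nonneg _))
      _ = _ := by
          have h₅ : √lam * √lam = lam := Real.mul_self_sqrt hlam.le
          have h₆ : √lam ≠ 0 := by positivity
          nth_rewrite 1 [← h₅]
          field_simp
  calc _ ≤ _ := abs_sub _ _
    _ ≤ _ := add_le_add h₁ h₄
    _ = _ := by ring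

/-- The total reward of arm `i` is not much smaller than the total mean reward. -/
theorem neg_noiseSum_le {T : ℕ} {θ : Vec d} {t : ℕ} (ht : t ≤ T) {h : Hist d K t}
    {i : Fin K} (hT : 1 ≤ T)
    (hE : ∀ n ∈ Finset.Icc 1 T, expProcess (-(2 * √(Real.log T / n))) θ i h < (T : ℝ) ^ 2) :
    -noiseSum θ h i ≤ 2 * √((pulls (obsHist h) i : ℝ) * Real.log T) := by
  -- The exponent is tuned to the pull count n, which is random; hence the hypothesis for every n in
  -- 1, ..., T, used at the actual count. Without pulls the sum is empty.
  rcases Nat.eq_zero_or_pos (pulls (obsHist h) i) with h0 | hpos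
  · have : pullRounds (obsHist h) i = ∅ := Finset.card_eq_zero.1 h0
    simp [noiseSum, this, h0]
  · have hT' : (1 : ℝ) ≤ T := by exact_mod_cast hT
    have hlog : 0 ≤ Real.log T := Real.log_nonneg hT'
    have hE := hE _ (Finset.mem_Icc.2 ⟨hpos, (pulls_le _ _).trans ht⟩)
    have hn : (0 : ℝ) < pulls (obsHist h) i := by exact_mod_cast hpos
    rw [expProcess, ← Real.lt_log_iff_exp_lt (by positivity), Real.log_pow] at hE
    set n : ℝ := (pulls (obsHist h) i : ℝ)
    have hs : √(Real.log T / n) ^ 2 = Real.log T / n := Real.sq_sqrt (by positivity)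
    -- With this exponent the variance term is 2 log T and the log threshold is 2 log T; dividing
    -- their sum by 2√(log T / n) gives the slack 2√(n log T) of the trigger.
    have h₁ : (-(2 * √(Real.log T / n))) ^ 2 / 2 * n = 2 * Real.log T := by
      rw [neg_sq, mul_pow, hs]
      field_simp
    rw [h₁] at hE
    push_cast at hE
    have h₂ : √(n * Real.log T) * √(Real.log T / n) = Real.log T := by
      rw [← Real.sqrt_mul (by positivity)]
      rw [show n * Real.log T * (Real.log T / n) = Real.log T ^ 2 by field_simp]
      exact Real.sqrt_sq hlog
    by_contra! hlt
    have := mul_le_mul_of_nonneg_right hlt.le (Real.sqrt_nonneg (Real.log T / n))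
    rw [mul_assoc, h₂] at this
    linarith

/-- The potential of the rounds in which arm `i` is played. -/
theorem sum_log_eq {lam : ℝ} (hlam : 0 < lam) {t : ℕ} (h : ObsHist d K t) (i : Fin K) :
    ∑ l ∈ pullRounds h i, Real.log (1 + (ObsRound.report (h l) i).ofLp ⬝ᵥ
        ((covMatrix lam (prefixHist h l l.isLt.le) i)⁻¹ *ᵥ (ObsRound.report (h l) i).ofLp)) =
      Real.log ((covMatrix lam h i).det / lam ^ d) := by
  induction t with
  | zero =>
    rw [det_covMatrix_zero, div_self (by positivity)]
    simp [pullRounds]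
  | succ t ih =>
    rw [sum_pullRounds_succ, covMatrix_succ]
    have := ih (prefixHist h t t.le_succ)
    have hV := posDef_covMatrix hlam (prefixHist h t t.le_succ) i
    refine (congrArg (· + _) this).trans ?_
    split_ifs with ha
    · have hw := dotProduct_inv_mulVec_nonneg hV (ObsRound.report (h (Fin.last t)) i).ofLp
      have hdet := hV.det_pos
      rw [det_add_vecMulVec hV, mul_div_right_comm, Real.log_mul (by positivity) (by positivity)]
      rfl
    · simp

/-- The elliptical potential lemma. -/
theorem sum_quadForm_le {lam : ℝ} (hlam : 0 < lam) {t : ℕ} {h : ObsHist d K t} {i : Fin K}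
    (hb : ∀ l, ‖ObsRound.report (h l) i‖ ≤ 1) :
    ∑ l ∈ pullRounds h i, (ObsRound.report (h l) i).ofLp ⬝ᵥ
        ((covMatrix lam (prefixHist h l l.isLt.le) i)⁻¹ *ᵥ (ObsRound.report (h l) i).ofLp) ≤
      (1 + 1 / lam) * (d * Real.log (1 + pulls h i / lam)) := by
  refine le_trans ?_ (mul_le_mul_of_nonneg_left ((sum_log_eq hlam h i).trans_le
    (log_det_covMatrix_le hlam hb)) (by positivity))
  rw [Finset.mul_sum]
  refine Finset.sum_le_sum fun l _ => ?_
  have hV := posDef_covMatrix hlam (prefixHist h l l.isLt.le) i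
  have hw := dotProduct_inv_mulVec_nonneg hV (ObsRound.report (h l) i).ofLp
  have hw1 := dotProduct_inv_mulVec_le hV hlam (fun y => by
      rw [quadForm_covMatrix]
      exact le_add_of_nonneg_right (Finset.sum_nonneg fun _ _ => sq_nonneg _))
      (ObsRound.report (h l) i).ofLp
  rw [dotProduct_eq_inner (ObsRound.report (h l) i) (ObsRound.report (h l) i),
    real_inner_self_eq_norm_sq] at hw1
  have hw2 : ‖ObsRound.report (h l) i‖ ^ 2 ≤ 1 := pow_le_one₀ (norm_nonneg _) (hb l)
  set w := (ObsRound.report (h l) i).ofLp ⬝ᵥ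
    ((covMatrix lam (prefixHist h l l.isLt.le) i)⁻¹ *ᵥ (ObsRound.report (h l) i).ofLp)
  have hw3 : w ≤ 1 / lam := hw1.trans (by gcongr)
  -- From w/(1 + w) ≤ log(1 + w) and w ≤ 1/lam follows w ≤ (1 + 1/lam) log(1 + w), and the
  -- logarithms telescope to the log determinant.
  have hlog := Real.one_sub_inv_le_log_of_pos (by linarith : 0 < 1 + w)
  have h1 : 1 - (1 + w)⁻¹ = w / (1 + w) := by field_simp; ring
  rw [h1, div_le_iff₀ (by linarith)] at hlog
  have hlog0 : 0 ≤ Real.log (1 + w) := Real.log_nonneg (by linarith)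
  calc w ≤ Real.log (1 + w) * (1 + w) := hlog
    _ ≤ Real.log (1 + w) * (1 + 1 / lam) := by gcongr
    _ = _ := mul_comm _ _

/-! ## The regret on the good event -/

/-- The noise processes of all arms stay below their thresholds. -/
def NoiseBounded (T : ℕ) (lam : ℝ) (θ : Vec d) (h : Hist d K T) : Prop :=
  ∀ (i : Fin K) (t : ℕ) (ht : t ≤ T), selfNormProcess lam θ i (prefixHist h t ht) < T ∧
    ∀ n ∈ Finset.Icc 1 T,
      expProcess (-(2 * √(Real.log T / n))) θ i (prefixHist h t ht) < (T : ℝ) ^ 2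

section Good

variable {T : ℕ} {lam S : ℝ} {θ : Vec d} {h : Hist d K T}

theorem abs_thetaHat_prefix_le (hT : 1 ≤ T) (hd : 1 ≤ d) (hlam : 0 < lam)
    (hgood : NoiseBounded T lam θ h) (hb : ∀ t i, ‖ObsRound.report (h t).2 i‖ ≤ 1)
    {i : Fin K} {θi : Vec d} (hθi : ‖θi‖ ≤ S)
    (hreal : ∀ t, inner ℝ θ ((h t).1 i) = inner ℝ θi (ObsRound.report (h t).2 i))
    (t : Fin T) :
    |thetaHat lam (prefixHist (obsHist h) t t.isLt.le) i ⬝ᵥ (ObsRound.report (h t).2 i).ofLp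
        - inner ℝ θ ((h t).1 i)| ≤
      confRadius T lam S (prefixHist (obsHist h) t t.isLt.le) i *
        invNorm lam (prefixHist (obsHist h) t t.isLt.le) i (ObsRound.report (h t).2 i) := by
  rw [hreal t]
  exact abs_thetaHat_sub_le (h := prefixHist h t t.isLt.le) hT hd hlam hθi (fun l => hb _ _)
    (fun l => hreal _) (hgood i t t.isLt.le).1 _

/-- On the good event no arm is ever eliminated. -/
theorem not_triggered (hT : 1 ≤ T) (hd : 1 ≤ d) (hlam : 0 < lam)
    (hgood : NoiseBounded T lam θ h) (hb : ∀ t i, ‖ObsRound.report (h t).2 i‖ ≤ 1)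
    {i : Fin K} {θi : Vec d} (hθi : ‖θi‖ ≤ S)
    (hreal : ∀ t, inner ℝ θ ((h t).1 i) = inner ℝ θi (ObsRound.report (h t).2 i))
    (t : ℕ) (ht : t ≤ T) : ¬ Triggered T lam S (prefixHist (obsHist h) t ht) i := by
  have hnoise := neg_noiseSum_le ht hT (hgood i t ht).2
  rw [Triggered, not_lt]
  have hsum : ∑ l ∈ pullRounds (prefixHist (obsHist h) t ht) i,
      lcb T lam S (prefixHist (prefixHist (obsHist h) t ht) l.val l.isLt.le) i
        (ObsRound.report (prefixHist (obsHist h) t ht l) i) ≤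
      ∑ l ∈ pullRounds (prefixHist (obsHist h) t ht) i,
        (ObsRound.reward (prefixHist (obsHist h) t ht l) - eta θ i (prefixHist h t ht l)) := by
    refine Finset.sum_le_sum fun l _ => ?_
    have := (abs_le.1 (abs_thetaHat_prefix_le hT hd hlam hgood hb hθi hreal (Fin.castLE ht l))).2
    have h₁ : ObsRound.reward (prefixHist (obsHist h) t ht l) - eta θ i (prefixHist h t ht l) =
        inner ℝ θ ((h (Fin.castLE ht l)).1 i) := sub_sub_cancel _ _
    rw [h₁]
    exact sub_le_iff_le_add.2 (sub_le_iff_le_add'.1 this)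
  rw [Finset.sum_sub_distrib] at hsum
  change -(∑ l ∈ pullRounds (prefixHist (obsHist h) t ht) i, eta θ i (prefixHist h t ht l)) ≤
    2 * √((pulls (prefixHist (obsHist h) t ht) i : ℝ) * Real.log T) at hnoise
  linarith

/-- The trigger fails at every time up to `T`, so the optimistic argmax always ranges over all arms.
-/
theorem active (hT : 1 ≤ T) (hd : 1 ≤ d) (hlam : 0 < lam)
    (hgood : NoiseBounded T lam θ h) (hb : ∀ t i, ‖ObsRound.report (h t).2 i‖ ≤ 1)
    (hreal : ∀ i : Fin K, ∃ θi : Vec d, ‖θi‖ ≤ S ∧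
      ∀ t, inner ℝ θ ((h t).1 i) = inner ℝ θi (ObsRound.report (h t).2 i))
    (t : ℕ) (ht : t ≤ T) (i : Fin K) : Active T lam S (prefixHist (obsHist h) t ht) i := by
  obtain ⟨θi, hθi, hi⟩ := hreal i
  exact fun s _ => not_triggered hT hd hlam hgood hb hθi hi (s.val + 1) (s.isLt.trans_le ht)

/-- The squared weighted norm of the report of the arm played in round `t`, and `0` if no arm is
played. -/
noncomputable def playedNormSq (lam : ℝ) (h : ObsHist d K T) (t : Fin T) : ℝ :=
  ∑ i : Fin K, if (h t).arm = some i then (ObsRound.report (h t) i).ofLp ⬝ᵥ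
    ((covMatrix lam (prefixHist h t t.isLt.le) i)⁻¹ *ᵥ (ObsRound.report (h t) i).ofLp) else 0

/-- Optimism: the mean of any arm j is at most its UCB, hence at most the UCB of the played arm,
which exceeds that arm's mean by at most two radii times the weighted norm. -/
theorem round_regret_le (hK : 1 ≤ K) (hT : 1 ≤ T) (hd : 1 ≤ d) (hlam : 0 < lam)
    (hgood : NoiseBounded T lam θ h) (hb : ∀ t i, ‖ObsRound.report (h t).2 i‖ ≤ 1)
    (hreal : ∀ i : Fin K, ∃ θi : Vec d, ‖θi‖ ≤ S ∧
      ∀ t, inner ℝ θ ((h t).1 i) = inner ℝ θi (ObsRound.report (h t).2 i))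
    {B : ℝ} (hB : ∀ (t : Fin T) i, confRadius T lam S (prefixHist (obsHist h) t t.isLt.le) i ≤ B)
    (t : Fin T)
    (hplay : (h t).2.arm ∈
      optGTMChoices T lam S (prefixHist (obsHist h) t t.isLt.le) (h t).2.report) :
    (⨆ i : Fin K, inner ℝ θ ((h t).1 i)) - meanReward θ (h t).1 (h t).2.arm ≤
      2 * B * √(playedNormSq lam (obsHist h) t) := by
  have : Nonempty (Fin K) := ⟨⟨0, hK⟩⟩
  rcases hplay with ⟨i, hi, -, hmax⟩ | ⟨-, hnone⟩
  · have hsq : √(playedNormSq lam (obsHist h) t) =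
        invNorm lam (prefixHist (obsHist h) t t.isLt.le) i (ObsRound.report (h t).2 i) := by
      rw [playedNormSq, Finset.sum_eq_single i]
      · exact congrArg Real.sqrt (if_pos hi)
      · exact fun j _ hj => if_neg fun hj' => hj (Option.some_injective _ (hj'.symm.trans hi))
      · simp
    rw [hi, meanReward, hsq, sub_le_iff_le_add]
    refine ciSup_le fun j => ?_
    obtain ⟨θi, hθi, hri⟩ := hreal i
    obtain ⟨θj, hθj, hrj⟩ := hreal j
    have h₁ := (abs_le.1 (abs_thetaHat_prefix_le hT hd hlam hgood hb hθj hrj t)).1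
    have h₂ := (abs_le.1 (abs_thetaHat_prefix_le hT hd hlam hgood hb hθi hri t)).2
    have h₃ := hmax j (active hT hd hlam hgood hb hreal t t.isLt.le j)
    have h₄ := mul_le_mul_of_nonneg_right (hB t i) (show 0 ≤
      invNorm lam (prefixHist (obsHist h) t t.isLt.le) i (ObsRound.report (h t).2 i) from
        Real.sqrt_nonneg _)
    rw [ucb, ucb] at h₃
    linarith
  · exact (hnone ⟨0, hK⟩ (active hT hd hlam hgood hb hreal t t.isLt.le _)).elim

theorem log_one_add_div_le (hT : 1 ≤ T) (hlam : 0 < lam) {n : ℕ} (hn : n ≤ T) :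
    Real.log (1 + n / lam) ≤ (1 + 1 / lam) * (1 + Real.log T) := by
  have hT' : (1 : ℝ) ≤ T := by exact_mod_cast hT
  have hn' : (n : ℝ) ≤ T := by exact_mod_cast hn
  have hlog : 0 ≤ Real.log T := Real.log_nonneg hT'
  have h₁ : (1 : ℝ) + n / lam ≤ (1 + 1 / lam) * T := by
    rw [add_mul, one_mul, div_mul_eq_mul_div, one_mul]
    gcongr
  have h₂ := Real.log_le_log (by positivity) h₁
  rw [Real.log_mul (by positivity) (by positivity)] at h₂
  have h₃ := Real.log_le_sub_one_of_pos (by positivity : 0 < 1 + 1 / lam)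
  have h₄ : 0 ≤ 1 / lam * Real.log T := by positivity
  linarith

/-- After exchanging the sums, each arm pays for its own covariance matrix through the elliptical
potential; this is the source of the factor `K`. -/
theorem sum_playedNormSq_le (hT : 1 ≤ T) (hlam : 0 < lam) {h : ObsHist d K T}
    (hb : ∀ t i, ‖ObsRound.report (h t) i‖ ≤ 1) :
    ∑ t, playedNormSq lam h t ≤ K * ((1 + 1 / lam) ^ 2 * (d * (1 + Real.log T))) := by
  unfold playedNormSq
  rw [Finset.sum_comm]
  have : ∀ i ∈ (Finset.univ : Finset (Fin K)), (∑ t : Fin T, if (h t).arm = some i then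
      (ObsRound.report (h t) i).ofLp ⬝ᵥ ((covMatrix lam (prefixHist h t t.isLt.le) i)⁻¹ *ᵥ
        (ObsRound.report (h t) i).ofLp) else 0) ≤ (1 + 1 / lam) ^ 2 * (d * (1 + Real.log T)) := by
    intro i _
    rw [← Finset.sum_filter]
    refine (sum_quadForm_le hlam fun l => hb l i).trans ?_
    calc _ ≤ (1 + 1 / lam) * (d * ((1 + 1 / lam) * (1 + Real.log T))) := by
          gcongr
          exact log_one_add_div_le hT hlam (pulls_le h i)
      _ = _ := by ring
  simpa using Finset.sum_le_card_nsmul _ _ _ this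

theorem confRadius_le (hT : 1 ≤ T) (hd : 1 ≤ d) (hlam : 0 < lam) (hS : 0 ≤ S) {t : ℕ} (ht : t ≤ T)
    (h : ObsHist d K t) (i : Fin K) :
    confRadius T lam S h i ≤
      (√(3 + 1 / lam) + √lam * S) * √(d * (1 + Real.log T)) := by
  have hT' : (1 : ℝ) ≤ T := by exact_mod_cast hT
  have hd' : (1 : ℝ) ≤ d := by exact_mod_cast hd
  have hlog : 0 ≤ Real.log T := Real.log_nonneg hT'
  rw [confRadius_eq hT hlam, add_mul, ← Real.sqrt_mul (by positivity)]
  refine add_le_add (Real.sqrt_le_sqrt ?_) (le_mul_of_one_le_right (by positivity) ?_)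
  · rw [mul_left_comm]
    gcongr
    have := log_one_add_div_le hT hlam ((pulls_le h i).trans ht)
    linarith
  · rw [Real.one_le_sqrt]
    nlinarith

theorem sum_regret_le (hK : 1 ≤ K) (hT : 1 ≤ T) (hd : 1 ≤ d) (hlam : 0 < lam) (hS : 0 ≤ S)
    (hgood : NoiseBounded T lam θ h) (hb : ∀ t i, ‖ObsRound.report (h t).2 i‖ ≤ 1)
    (hreal : ∀ i : Fin K, ∃ θi : Vec d, ‖θi‖ ≤ S ∧
      ∀ t, inner ℝ θ ((h t).1 i) = inner ℝ θi (ObsRound.report (h t).2 i))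
    (hplay : ∀ t : Fin T, (h t).2.arm ∈
      optGTMChoices T lam S (prefixHist (obsHist h) t t.isLt.le) (h t).2.report) :
    ∑ t : Fin T, ((⨆ i : Fin K, inner ℝ θ ((h t).1 i)) - meanReward θ (h t).1 (h t).2.arm) ≤
      2 * (1 + 1 / lam) * (√(3 + 1 / lam) + √lam * S) * d * (1 + Real.log T) * √((K : ℝ) * T) := by
  have hT' : (1 : ℝ) ≤ T := by exact_mod_cast hT
  have hlog : 0 ≤ Real.log T := Real.log_nonneg hT'
  set B := (√(3 + 1 / lam) + √lam * S) * √(d * (1 + Real.log T)) with hBdef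
  have hB0 : 0 ≤ B := by positivity
  have hy : ∀ t, 0 ≤ playedNormSq lam (obsHist h) t := fun t =>
    Finset.sum_nonneg fun i _ => by
      split_ifs
      · exact dotProduct_inv_mulVec_nonneg (posDef_covMatrix hlam _ i) _
      · rfl
  -- Cauchy-Schwarz over all rounds at once, rather than arm by arm, produces √(KT).
  have h₁ : ∑ t : Fin T, √(playedNormSq lam (obsHist h) t) ≤
      √(T * ∑ t, playedNormSq lam (obsHist h) t) := by
    refine Real.le_sqrt_of_sq_le ?_
    have := sq_sum_le_card_mul_sum_sq (s := Finset.univ)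
      (f := fun t : Fin T => √(playedNormSq lam (obsHist h) t))
    simpa only [Finset.card_univ, Fintype.card_fin, Real.sq_sqrt (hy _)] using this
  calc _ ≤ ∑ t : Fin T, 2 * B * √(playedNormSq lam (obsHist h) t) :=
        Finset.sum_le_sum fun t _ => round_regret_le hK hT hd hlam hgood hb hreal
          (fun t i => confRadius_le hT hd hlam hS t.isLt.le _ i) t (hplay t)
    _ ≤ 2 * B * √(T * (K * ((1 + 1 / lam) ^ 2 * (d * (1 + Real.log T))))) := by
        rw [← Finset.mul_sum]
        gcongr
        refine h₁.trans (Real.sqrt_le_sqrt ?_)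
        gcongr
        exact sum_playedNormSq_le hT hlam hb
    _ = _ := by
        have h₂ : (T : ℝ) * (K * ((1 + 1 / lam) ^ 2 * (d * (1 + Real.log T)))) =
            (1 + 1 / lam) ^ 2 * (d * (1 + Real.log T)) * (K * T) := by ring
        rw [h₂, Real.sqrt_mul (by positivity), Real.sqrt_mul (by positivity),
          Real.sqrt_sq (by positivity), hBdef]
        have h₃ : √(d * (1 + Real.log T)) * √(d * (1 + Real.log T)) = d * (1 + Real.log T) :=
          Real.mul_self_sqrt (by positivity)
        linear_combination 2 * (1 + 1 / lam) * (√(3 + 1 / lam) + √lam * S) * √((K : ℝ) * T) * h₃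

end Good

end StrategicBandit

namespace StrategicBandit

variable {d K : ℕ}

/-! ## The probability of the good event -/

/-- The sum of all noise processes, scaled so that the good event fails only if it reaches `T`. -/
noncomputable def totalProcess (T : ℕ) (lam : ℝ) (θ : Vec d) (t : ℕ) (h : Hist d K t) : ENNReal :=
  ∑ i : Fin K, (ENNReal.ofReal (selfNormProcess lam θ i h) +
    ∑ n ∈ Finset.Icc 1 T, (T : ENNReal)⁻¹ *
      ENNReal.ofReal (expProcess (-(2 * √(Real.log T / n))) θ i h))

theorem isSupermart_totalProcess {env : Environment d K} {S : ℝ} (hreg : env.Regular S)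
    (M : Algorithm d K) (σ : Fin K → Strategy d K) (T : ℕ) {lam : ℝ} (hlam : 0 < lam) :
    IsSupermart env M σ (totalProcess T lam env.theta) :=
  IsSupermart.sum _ fun i _ => (isSupermart_selfNormProcess hreg M σ hlam i).add
    (IsSupermart.sum _ fun _ _ => (isSupermart_expProcess hreg M σ _ i).const_mul _)

theorem totalProcess_zero {T : ℕ} (hT : 1 ≤ T) {lam : ℝ} (hlam : 0 < lam) (θ : Vec d)
    (h : Hist d K 0) : totalProcess T lam θ 0 h = 2 * K := by
  have hT0 : (T : ENNReal) ≠ 0 := by exact_mod_cast (by omega : T ≠ 0)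
  have h₁ : ∀ i : Fin K, selfNormProcess lam θ i h = 1 := fun i => by
    rw [selfNormProcess, det_covMatrix_zero, div_self (by positivity)]
    simp [noiseVec, pullRounds]
  have h₂ : ∀ (s : ℝ) (i : Fin K), expProcess s θ i h = 1 := fun s i => by
    simp [expProcess, noiseSum, pulls, pullRounds]
  simp only [totalProcess, h₁, h₂, ENNReal.ofReal_one, mul_one, Finset.sum_const, Nat.card_Icc,
    Nat.add_sub_cancel, nsmul_eq_mul, ENNReal.mul_inv_cancel hT0 (ENNReal.natCast_ne_top T),
    Finset.card_univ, Fintype.card_fin, one_add_one_eq_two]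
  exact mul_comm _ _

/-- All summands are nonnegative, so each stays below `T`; the weight 1/T turns this into the
threshold T² for the exponential processes. These weights sum to 1 over n, so each arm contributes
only 2 to the initial value. -/
theorem noiseBounded_of_totalProcess_lt {T : ℕ} (hT : 1 ≤ T) {lam : ℝ} {θ : Vec d} {h : Hist d K T}
    (hh : ∀ (t : ℕ) (ht : t ≤ T), totalProcess T lam θ t (prefixHist h t ht) < T) :
    NoiseBounded T lam θ h := by
  intro i t ht
  have hT0 : (T : ENNReal) ≠ 0 := by exact_mod_cast (by omega : T ≠ 0)
  have h₁ := (Finset.single_le_sum (fun _ _ => zero_le) (Finset.mem_univ i)).trans_lt (hh t ht)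
  refine ⟨?_, fun n hn => ?_⟩
  · have := le_self_add.trans_lt h₁
    rwa [← ENNReal.ofReal_natCast, ENNReal.ofReal_lt_ofReal_iff_of_nonneg (by
      unfold selfNormProcess; positivity)] at this
  · have h₂ := (Finset.single_le_sum (fun _ _ => zero_le) hn).trans_lt (le_add_self.trans_lt h₁)
    rw [mul_comm, ← div_eq_mul_inv, ENNReal.div_lt_iff (Or.inl hT0)
      (Or.inl (ENNReal.natCast_ne_top T)), ← sq, ← ENNReal.ofReal_natCast,
      ← ENNReal.ofReal_pow (by positivity), ENNReal.ofReal_lt_ofReal_iff_of_nonneg (by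
        unfold expProcess; positivity)] at h₂
    exact h₂

/-- The event that the sum of the noise processes reaches `T`. -/
def badEvent (T : ℕ) (lam : ℝ) (θ : Vec d) : Set (Hist d K T) :=
  {h | ∃ (t : ℕ) (ht : t ≤ T), (T : ENNReal) ≤ totalProcess T lam θ t (prefixHist h t ht)}

theorem measureReal_badEvent_le {env : Environment d K} {S : ℝ} (hreg : env.Regular S)
    (M : Algorithm d K) (σ : Fin K → Strategy d K) {T : ℕ} (hT : 1 ≤ T) {lam : ℝ} (hlam : 0 < lam) :
    T * (law env M σ T).real (badEvent T lam env.theta) ≤ 2 * √((K : ℝ) * T) := by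
  have h₁ := (isSupermart_totalProcess hreg M σ T hlam).ville T T
  rw [totalProcess_zero hT hlam] at h₁
  have h₂ : T * (law env M σ T).real (badEvent T lam env.theta) ≤ 2 * K := by
    have := ENNReal.toReal_mono (by finiteness) h₁
    rw [ENNReal.toReal_mul, ENNReal.toReal_mul] at this
    exact this
  have h₃ : T * (law env M σ T).real (badEvent T lam env.theta) ≤ T :=
    mul_le_of_le_one_right (by positivity) measureReal_le_one
  have h₄ : 0 ≤ T * (law env M σ T).real (badEvent T lam env.theta) := by positivity
  have h₅ : √((K : ℝ) * T) ^ 2 = K * T := Real.sq_sqrt (by positivity)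
  -- The quantity is bounded by both 2K and T, so its square is at most 2KT ≤ 4KT. No case
  -- distinction between K and T is needed.
  refine le_of_sq_le_sq ?_ (by positivity)
  rw [mul_pow 2, h₅]
  nlinarith [mul_le_mul h₂ h₃ h₄ (by positivity : (0 : ℝ) ≤ 2 * K),
    (by positivity : (0 : ℝ) ≤ K * T)]

/-! ## The strategic regret -/

theorem ae_contexts_bounded {env : Environment d K} {S : ℝ} (hreg : env.Regular S)
    (M : Algorithm d K) (σ : Fin K → Strategy d K) (T : ℕ) :
    ∀ᵐ h ∂(law env M σ T), ∀ (t : Fin T) (i : Fin K), ‖(h t).1 i‖ ≤ 1 := by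
  have hm : MeasurableSet {x : Contexts d K | ∀ i, ‖x i‖ ≤ 1} := by
    rw [Set.ofPred_forall]
    exact MeasurableSet.iInter fun i =>
      measurableSet_le (by fun_prop : Measurable fun x : Contexts d K => ‖x i‖) measurable_const
  exact ae_law_of_ae_roundKernel env M σ (Q := fun _ _ r => ∀ i, ‖r.1 i‖ ≤ 1)
    (fun t => hm.preimage (by fun_prop : Measurable fun p : Hist d K t × Round d K => p.2.1))
    (fun t h => ae_roundKernel_contexts env M σ h hm
      ((hreg.nature_bounded t h).mono fun x hx => hx.1)) T

theorem ae_arm_mem_optGTMChoices (env : Environment d K) {M : Algorithm d K}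
    (σ : Fin K → Strategy d K) {T : ℕ} {lam S : ℝ} (hM : IsOptGTM T lam S M) :
    ∀ᵐ h ∂(law env M σ T), ∀ t : Fin T, (h t).2.arm ∈
      optGTMChoices T lam S (prefixHist (obsHist h) t t.isLt.le) (h t).2.report := by
  filter_upwards [ae_law_of_ae_roundKernel env M σ (measurableSet_select_ne_zero M)
    (fun t h => ae_roundKernel_select env M σ h) T] with h hh t
  by_contra hmem
  -- A play outside the allowed choices would be an atom inside a null set, contradicting its
  -- positive mass.
  refine hh t (measure_mono_null ?_ (hM t (obsHist (prefixHist h t t.isLt.le)) (h t).2.report))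
  exact Set.singleton_subset_iff.2 hmem

/-- The regret of the play of one round. -/
noncomputable def roundRegret (θ : Vec d) (r : Round d K) : ℝ :=
  (⨆ i : Fin K, inner ℝ θ (r.1 i)) - meanReward θ r.1 r.2.arm

theorem measurable_roundRegret (θ : Vec d) : Measurable (roundRegret (K := K) θ) := by
  refine (Measurable.iSup fun i => by fun_prop).sub ?_
  have h : Measurable fun p : Play K × Contexts d K => meanReward θ p.2 p.1 := by
    refine measurable_from_prod_countable_right fun a => ?_
    cases a with
    | none => exact measurable_const
    | some i =>
      simp only [meanReward]
      fun_prop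
  exact h.comp (by fun_prop : Measurable fun r : Round d K => (r.2.2.1, r.1))

theorem abs_roundRegret_le (hK : 1 ≤ K) {θ : Vec d} {S : ℝ} (hθ : ‖θ‖ ≤ S) {r : Round d K}
    (hr : ∀ i, ‖r.1 i‖ ≤ 1) : |roundRegret θ r| ≤ 2 * S := by
  have : Nonempty (Fin K) := ⟨⟨0, hK⟩⟩
  have hS : 0 ≤ S := (norm_nonneg _).trans hθ
  have h₁ : ∀ i, |inner ℝ θ (r.1 i)| ≤ S := fun i =>
    (abs_real_inner_le_norm _ _).trans (by
      simpa using mul_le_mul hθ (hr i) (norm_nonneg _) hS)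
  have h₂ : |⨆ i : Fin K, inner ℝ θ (r.1 i)| ≤ S :=
    abs_le.2 ⟨(abs_le.1 (h₁ ⟨0, hK⟩)).1.trans (le_ciSup (f := fun i => inner ℝ θ (r.1 i))
      (Set.finite_range _).bddAbove _),
      ciSup_le fun i => (abs_le.1 (h₁ i)).2⟩
  have h₃ : |meanReward θ r.1 r.2.arm| ≤ S := by
    cases r.2.arm with
    | none => simpa [meanReward] using hS
    | some i => exact h₁ i
  refine (abs_sub _ _).trans ?_
  linarith

end StrategicBandit

/-! ### Combining the good and the bad event -/

theorem mainTheorem6 (lam S : ℝ) (hlam : 0 < lam) (hS : 0 ≤ S) :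
    ∃ C : ℝ, 0 < C ∧
      ∀ (d K T : ℕ), 1 ≤ d → 1 ≤ K → 1 ≤ T →
      ∀ (env : StrategicBandit.Environment d K), env.Regular S →
      ∀ (M : StrategicBandit.Algorithm d K), StrategicBandit.IsOptGTM T lam S M →
      ∀ (Adm : Fin K → Set (StrategicBandit.Strategy d K))
        (σ : Fin K → StrategicBandit.Strategy d K),
        StrategicBandit.IsNash env M T Adm σ →
        StrategicBandit.LinearlyRealizable env M T S σ →
        StrategicBandit.BoundedReports env M T σ →
        StrategicBandit.regret env M T σ
          ≤ C * d * (1 + Real.log T) * Real.sqrt ((K : ℝ) * T) := by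
  open StrategicBandit in
  -- The first summand is the constant of `sum_regret_le`; 4S is the regret bound 2S per round times
  -- the 2 in `measureReal_badEvent_le`.
  refine ⟨2 * (1 + 1 / lam) * (√(3 + 1 / lam) + √lam * S) + 4 * S, by positivity, ?_⟩
  intro d K T hd hK hT env hreg M hM Adm σ _ hreal hbdd
  have hd' : (1 : ℝ) ≤ d := by exact_mod_cast hd
  have hlog : 0 ≤ Real.log T := Real.log_nonneg (by exact_mod_cast hT)
  set G := 2 * (1 + 1 / lam) * (√(3 + 1 / lam) + √lam * S) * d * (1 + Real.log T) *
    √((K : ℝ) * T) with hG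
  have hG0 : 0 ≤ G := by positivity
  have hX : MeasurableSet (badEvent (K := K) T lam env.theta) :=
    measurableSet_crossing (isSupermart_totalProcess hreg M σ T hlam).measurable T T
  have habs : ∀ᵐ h ∂(law env M σ T), |∑ t, roundRegret env.theta (h t)| ≤ T * (2 * S) := by
    filter_upwards [ae_contexts_bounded hreg M σ T] with h hh
    refine (Finset.abs_sum_le_sum_abs _ _).trans ?_
    simpa using Finset.sum_le_card_nsmul Finset.univ _ _ fun t _ =>
      abs_roundRegret_le hK hreg.norm_theta_le (hh t)
  have hint : Integrable (fun h => ∑ t, roundRegret env.theta (h t)) (law env M σ T) :=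
    Integrable.of_bound (Finset.measurable_fun_sum _ fun t _ =>
      (measurable_roundRegret env.theta).comp (measurable_pi_apply t)).aestronglyMeasurable _ habs
  -- The realizing parameters are chosen history by history, which is legitimate because the good
  -- event is defined without them.
  have hle : ∀ᵐ h ∂(law env M σ T), ∑ t, roundRegret env.theta (h t) ≤
      G + (badEvent T lam env.theta).indicator (fun _ => T * (2 * S)) h := by
    filter_upwards [habs, hreal, hbdd, ae_arm_mem_optGTMChoices env σ hM] with h h₁ h₂ h₃ h₄
    by_cases hh : h ∈ badEvent T lam env.theta
    · rw [Set.indicator_of_mem hh]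
      linarith [le_of_abs_le h₁]
    · rw [Set.indicator_of_notMem hh, add_zero]
      refine sum_regret_le hK hT hd hlam hS (noiseBounded_of_totalProcess_lt hT fun t ht => ?_)
        h₃ h₂ h₄
      by_contra! hle
      exact hh ⟨t, ht, hle⟩
  calc regret env M T σ = ∫ h, ∑ t, roundRegret env.theta (h t) ∂(law env M σ T) := rfl
    _ ≤ ∫ h, (G + (badEvent T lam env.theta).indicator (fun _ => T * (2 * S)) h)
        ∂(law env M σ T) :=
      integral_mono_ae hint
        ((integrable_const _).add ((integrable_const _).indicator hX)) hle
    _ = G + 2 * S * (T * (law env M σ T).real (badEvent T lam env.theta)) := by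
      rw [integral_add (integrable_const _) ((integrable_const _).indicator hX),
        integral_indicator_const _ hX]
      simp
      ring
    _ ≤ G + 2 * S * (2 * √((K : ℝ) * T)) := by
      have := measureReal_badEvent_le hreg M σ hT hlam
      gcongr G + 2 * S * ?_
    _ ≤ G + 4 * S * (d * (1 + Real.log T)) * √((K : ℝ) * T) := by
      have : (1 : ℝ) ≤ d * (1 + Real.log T) := by nlinarith
      have := mul_le_mul_of_nonneg_left this
        (by positivity : 0 ≤ 4 * S * √((K : ℝ) * T))
      linarith
    _ = _ := by rw [hG]; ring
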